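/- Consider the tree-level process $B^*(q)+Q_1(k_1)\to Q_2(k_2)+g(p)$ of a virtual boson with $Q^2=-q^2>0$, quarks of masses $m_1,m_2\ge 0$ and one gluon, with $k_1+q=k_2+p$, $k_1^2=m_1^2$, $k_2^2=m_2^2$, $p^2=0$ and positive energies. The current vertex is $\gamma_\mu(V-A\gamma_5)$ in the amplitude $\mathcal M_\mu(V,A)$ and $\gamma_\mu(V'-A'\gamma_5)$ in the conjugate amplitude, with real $V,A,V',A'$. The amplitude is the sum of the two diagrams in which the gluon is radiated from the outgoing or from the incoming quark, with $SU(3)$ colour and coupling $g_s\neq 0$; the boson polarization vector is stripped off. Put $\overline{\hat W_{\mu\nu}}=\frac13\sum_{\rm color}\frac12\sum_{\rm spins}\mathcal M_\mu(V,A)\,\mathcal M_\nu(V',A')^*$, where the spin sum runs over two orthogonal spin states of each quark and two physical polarizations of the gluon. With $C_F=\frac43$ put $$\hat F_i=\Big(C_F\tfrac{g_s^2}{2}\Big)^{-1}P_i^{\mu\nu}(k_1,q)\,\overline{\hat W_{\mu\nu}},\qquad i=4,5,$$ with the four-dimensional projectors $$P_4^{\mu\nu}(P,q)=\frac{2Q^2}{D^2}\Big(P^2g^{\mu\nu}+\frac4{D^2}\Big[\big(\tfrac{D^2}2-3P^2Q^2\big)P^\mu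 P^\nu+3P^4q^\mu q^\nu-3P^2(P\cdot q)(P^\mu q^\nu+q^\mu P^\nu)\Big]\Big),$$ $$P_5^{\mu\nu}(P,q)=-\frac{4P\cdot q}{D^2}\Big(-\frac{12}{D^2}\Big[Q^2(P\cdot q)P^\mu P^\nu-P^2(P\cdot q)q^\mu q^\nu+\big(\tfrac{D^2}6-Q^2P^2\big)(P^\mu q^\nu+q^\mu P^\nu)\Big]+(P\cdot q)g^{\mu\nu}\Big),$$ where $D=\Delta((P+q)^2,P^2,-Q^2)$ and $\Delta(a,b,c)=\sqrt{a^2+b^2+c^2-2ab-2ac-2bc}$. Write $\hat s_1=(k_1+q)^2-m_2^2$, $\hat t_1=(k_2-q)^2-m_1^2$, $q_\pm=VV'\pm AA'$, $\Sigma_{\pm\pm}=Q^2\pm m_2^2\pm m_1^2$ (first sign for $m_2^2$), $\Delta=\Delta(m_1^2,m_2^2,-Q^2)$, $\Delta'=\Delta(m_1^2,\hat s_1+m_2^2,-Q^2)$. **(i) Semi-inclusive.** If $\hat s_1\ne0$ and $\hat t_1\neq0$, then $\hat F_4$ and $\hat F_5$ depend on the momenta only through $Q^2,\hat s_1,\hat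 t_1$, and $$\begin{aligned}\hat F_4(\hat s_1,\hat t_1)=&-16\frac{Q^2}{\Delta'^4}\Big\{q_+\Big[2\Delta^2m_1^2+\Sigma_{++}^2(7m_1^2+2m_2^2-Q^2)+\hat s_1(-2\Delta^2+14m_1^2\Sigma_{++}-\Sigma_{+-}^2)+\frac{4\Delta^2m_2^2m_1^2}{\hat s_1}\\&+\hat s_1^2(2m_1^2-3\Sigma_{+-})+\frac{m_1^2\hat s_1(11\Delta^2+36m_1^2m_2^2-\Sigma_{+-}\Sigma_{++})}{\hat t_1}+\frac{4\Delta^2m_1^4\hat s_1}{\hat t_1^2}+\frac{4m_1^4\hat s_1^2(2\Sigma_{++}-m_1^2)}{\hat t_1^2}\\&+\frac{6m_2^2m_1^2\Sigma_{++}\hat t_1}{\hat s_1}+\frac{4m_1^2\hat s_1^2(m_1^2+2\Sigma_{++})}{\hat t_1}+\frac{4m_1^4\hat s_1^3}{\hat t_1^2}+\frac{2m_1^2\hat s_1^3}{\hat t_1}-3m_2^2\Sigma_{+-}^2+\frac{4\Delta^2m_1^2\Sigma_{++}}{\hat t_1}\\&+\hat t_1\big(\Sigma_{++}(4m_1^2-\Sigma_{+-})+4m_1^2m_2^2\big)-2\hat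 s_1\hat t_1\Sigma_{+-}-\hat s_1^2\hat t_1-\hat s_1^3\Big]\\&-2m_1m_2q_-\Big[\frac{\hat t_1(\Delta^2+6m_1^2m_2^2)}{\hat s_1}+6m_1^2\Big(\frac{m_1^2\hat s_1}{\hat t_1}+\hat s_1+\Sigma_{++}\Big)+\hat t_1\big(2(m_1^2+\Sigma_{++})+\hat s_1\big)\Big]\Big\},\end{aligned}$$ and, for $\hat x\neq0$ determined by $\hat s_1=m_1^2-m_2^2+Q^2(1/\hat x-1)$, $$\begin{aligned}\hat F_5(\hat s_1,\hat t_1)=&-8\frac{Q^2}{\hat x\Delta'^4}\Big\{q_+\Big[-2\Delta'^2(5m_1^2+m_2^2+2Q^2)+\hat t_1\big(\hat s_1(-7m_1^2-m_2^2-3Q^2)-12m_1^2m_2^2+\hat s_1^2+\Sigma_{++}(\Sigma_{-+}-4\Sigma_{+-})\big)\\&+\frac{2\Delta^4m_2^2}{\hat s_1^2}+\hat s_1\big(-3\Delta^2-28m_1^2m_2^2-\Sigma_{-+}\Sigma_{++}-6\Sigma_{+-}^2+12\Sigma_{+-}\Sigma_{++}\big)-\Sigma_{+-}\Sigma_{++}(7\Sigma_{++}-4m_2^2)\\&+\Delta^2(13\Sigma_{++}-2Q^2)+\frac{2\Delta^4\Sigma_{++}}{\hat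 t_1\hat s_1}+\frac{2m_1^2\hat s_1^3(\Sigma_{+-}-2m_1^2)}{\hat t_1^2}\\&+\frac{4\Delta^2(2\Delta^2-m_1^2\Sigma_{++}+6m_1^2m_2^2)+\hat s_1^2(-2\Delta^2-20m_1^2m_2^2+4\Sigma_{+-}^2+9\Sigma_{+-}\Sigma_{++})}{\hat t_1}\\&+\frac{\hat s_1\big(\Sigma_{++}(9\Delta^2-2m_1^2\Sigma_{+-}+4\Sigma_{+-}^2)-6\Delta^2m_1^2\big)+\hat s_1^3(5\Sigma_{+-}-4m_1^2)+\hat s_1^4}{\hat t_1}\\&+\frac{\Delta^2(5\Delta^2+8m_1^2m_2^2-3\Sigma_{-+}\Sigma_{++})+\hat t_1\big(\Delta^2\Sigma_{++}+2m_2^2(\Delta^2-3\Sigma_{+-}\Sigma_{++})\big)}{\hat s_1}\\&+\frac{2\Delta^4m_1^2+2m_1^2\hat s_1^2\big(\Delta^2+2\Sigma_{++}(\Sigma_{+-}-m_1^2)+4m_1^4\big)+2\Delta^2m_1^2\hat s_1(3\Sigma_{++}-2m_1^2)}{\hat t_1^2}\Big]\\&+2m_1m_2q_-\Big[2(3\Sigma_{+-}\Sigma_{++}-\Delta^2)+\frac{6m_1^2\hat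 s_1(\hat s_1+\Sigma_{+-})}{\hat t_1}+4\hat s_1(-m_1^2+\hat s_1+2\Sigma_{++}+\hat t_1)\\&+2\hat t_1(3m_2^2+\Sigma_{+-})+\frac{\hat t_1(\Delta^2-3\Sigma_{-+}\Sigma_{++})}{\hat s_1}\Big]\Big\}.\end{aligned}$$ **(ii) Inclusive.** Let $m_1>0$, $Q^2>0$, $\hat s_1>0$. In the centre-of-mass frame $\vec k_1+\vec q=0$ let $\theta_{\rm CM}$ be the angle between $\vec k_2$ and $\vec k_1$ and let $y=\frac12(1-\cos\theta_{\rm CM})$. Every $y\in[0,1]$ occurs, and $$\hat t_1=\hat t_1(y)=\frac{\hat s_1}{\hat s_1+m_2^2}\Delta'(y-y_0),\qquad y_0=\tfrac12\big[1+(\Sigma_{++}+\hat s_1)/\Delta'\big].$$ The functions $1/\hat t_1(y)^2$, $1/\hat t_1(y)$ and $\hat t_1(y)$ have the following integrals over $y\in[0,1]$, respectively: $$\frac{\hat s_1+m_2^2}{m_1^2\hat s_1^2},\qquad \frac{\hat s_1+m_2^2}{\hat s_1\Delta'}\mathcal L,\qquad -\frac{\hat s_1(\Sigma_{++}+\hat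 s_1)}{2(\hat s_1+m_2^2)},\qquad\text{where}\quad \mathcal L=\ln\frac{\Sigma_{++}+\hat s_1-\Delta'}{\Sigma_{++}+\hat s_1+\Delta'}.$$ For $i=4,5$ the function $y\mapsto\hat F_i$ is integrable on $[0,1]$, and the inclusive structure function $\hat F_i(\hat s_1)=\int_0^1\hat F_i(\hat s_1,\hat t_1(y))\,dy$ is obtained from the expression in (i) by replacing $1/\hat t_1^2$, $1/\hat t_1$ and $\hat t_1$ by these three quantities. -/

import Mathlib

open Matrix

noncomputable section

namespace QuarkScattering

/-! ### Minkowski space, Dirac and Gell-Mann matrices -/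

/-- Contravariant real four-vectors `a^μ`. -/
abbrev FourVec := Fin 4 → ℝ

/-- The diagonal of the metric `g = diag(1, -1, -1, -1)`. -/
def metricSign : Fin 4 → ℝ := ![1, -1, -1, -1]

/-- The metric with upper indices, `g^{μν}`. -/
def metricUp (μ ν : Fin 4) : ℝ := if μ = ν then metricSign μ else 0

/-- The Minkowski product `a · b`. -/
def mdot (a b : FourVec) : ℝ := ∑ μ, metricSign μ * a μ * b μ

/-- The spatial part of a four-vector, in Euclidean three-space. -/
def spatial (a : FourVec) : EuclideanSpace ℝ (Fin 3) := !₂[a 1, a 2, a 3]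

/-- The Dirac matrices `γ^μ` (Dirac representation). -/
def gammaUp : Fin 4 → Matrix (Fin 4) (Fin 4) ℂ :=
  ![!![1, 0, 0, 0; 0, 1, 0, 0; 0, 0, -1, 0; 0, 0, 0, -1],
    !![0, 0, 0, 1; 0, 0, 1, 0; 0, -1, 0, 0; -1, 0, 0, 0],
    !![0, 0, 0, -Complex.I; 0, 0, Complex.I, 0; 0, Complex.I, 0, 0; -Complex.I, 0, 0, 0],
    !![0, 0, 1, 0; 0, 0, 0, -1; -1, 0, 0, 0; 0, 1, 0, 0]]

/-- The Dirac matrices with lower index, `γ_μ = g_{μν} γ^ν`. -/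
def gammaLow (μ : Fin 4) : Matrix (Fin 4) (Fin 4) ℂ := (metricSign μ : ℂ) • gammaUp μ

/-- `γ₅ = i γ⁰ γ¹ γ² γ³`. -/
def gammaFive : Matrix (Fin 4) (Fin 4) ℂ :=
  Complex.I • (gammaUp 0 * gammaUp 1 * gammaUp 2 * gammaUp 3)

/-- The contraction `v^μ γ_μ` of a complex four-vector. -/
def slashC (v : Fin 4 → ℂ) : Matrix (Fin 4) (Fin 4) ℂ := ∑ μ, v μ • gammaLow μ

/-- The contraction `k^μ γ_μ` of a real four-vector. -/
def slash (k : FourVec) : Matrix (Fin 4) (Fin 4) ℂ := slashC (fun μ => (k μ : ℂ))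

/-- The eight Gell-Mann matrices. -/
def gellMann : Fin 8 → Matrix (Fin 3) (Fin 3) ℂ :=
  ![!![0, 1, 0; 1, 0, 0; 0, 0, 0],
    !![0, -Complex.I, 0; Complex.I, 0, 0; 0, 0, 0],
    !![1, 0, 0; 0, -1, 0; 0, 0, 0],
    !![0, 0, 1; 0, 0, 0; 1, 0, 0],
    !![0, 0, -Complex.I; 0, 0, 0; Complex.I, 0, 0],
    !![0, 0, 0; 0, 0, 1; 0, 1, 0],
    !![0, 0, 0; 0, 0, -Complex.I; 0, Complex.I, 0],
    (((Real.sqrt 3)⁻¹ : ℝ) : ℂ) • !![1, 0, 0; 0, 1, 0; 0, 0, -2]]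

/-- The colour generators `T^a = λ^a / 2` of the fundamental representation of `SU(3)`. -/
def colorGen (a : Fin 8) : Matrix (Fin 3) (Fin 3) ℂ := (1 / 2 : ℂ) • gellMann a

/-- The quadratic Casimir `C_F = 4/3` of the fundamental representation of `SU(3)`. -/
def casimirF : ℝ := 4 / 3

/-! ### The process `B*(q) + Q₁(k₁) → Q₂(k₂) + g(p)` -/

/-- Vector and axial couplings `(V, A)` of the current in the amplitude, and `(V', A')` of the
current in the conjugate amplitude. -/
structure Couplings where
  V : ℝ
  A : ℝ
  Vp : ℝ
  Ap : ℝ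

/-- `q₊ = V V' + A A'`. -/
def Couplings.qPlus (c : Couplings) : ℝ := c.V * c.Vp + c.A * c.Ap

/-- `q₋ = V V' - A A'`. -/
def Couplings.qMinus (c : Couplings) : ℝ := c.V * c.Vp - c.A * c.Ap

/-- The four momenta of the process. -/
structure Momenta where
  k₁ : FourVec
  q : FourVec
  k₂ : FourVec
  p : FourVec

/-- Physical momenta: four-momentum conservation, on-shell quarks of masses `m₁`, `m₂` and an
on-shell gluon, all of positive energy, and a space-like boson. -/
structure Momenta.IsPhysical (K : Momenta) (m₁ m₂ : ℝ) : Prop where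
  conservation : K.k₁ + K.q = K.k₂ + K.p
  shell_k₁ : mdot K.k₁ K.k₁ = m₁ ^ 2
  shell_k₂ : mdot K.k₂ K.k₂ = m₂ ^ 2
  shell_p : mdot K.p K.p = 0
  energy_k₁ : 0 < K.k₁ 0
  energy_k₂ : 0 < K.k₂ 0
  energy_p : 0 < K.p 0
  spacelike : mdot K.q K.q < 0

/-- The virtuality `Q² = -q²`. -/
def Momenta.Qsq (K : Momenta) : ℝ := -mdot K.q K.q

/-- `ŝ₁ = (k₁ + q)² - m₂²`. -/
def Momenta.s₁ (K : Momenta) (m₂ : ℝ) : ℝ := mdot (K.k₁ + K.q) (K.k₁ + K.q) - m₂ ^ 2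

/-- `t̂₁ = (k₂ - q)² - m₁²`. -/
def Momenta.t₁ (K : Momenta) (m₁ : ℝ) : ℝ := mdot (K.k₂ - K.q) (K.k₂ - K.q) - m₁ ^ 2

/-- The external wave functions: two spinors for each quark, two gluon polarization vectors. -/
structure ExternalStates where
  u₁ : Fin 2 → Fin 4 → ℂ
  u₂ : Fin 2 → Fin 4 → ℂ
  pol : Fin 2 → Fin 4 → ℂ

/-- The two spin states of a quark of momentum `k` and mass `m`: solutions of the Dirac equation
`(k^μ γ_μ - m) u = 0`, orthogonal, and normalized by `u† u = 2 k⁰` (equivalent to `ū u = 2 m`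
if `m > 0`, and also meaningful if `m = 0`). -/
structure IsSpinBasis (k : FourVec) (m : ℝ) (u : Fin 2 → Fin 4 → ℂ) : Prop where
  dirac : ∀ s, slash k *ᵥ u s = (m : ℂ) • u s
  normalized : ∀ s r, star (u s) ⬝ᵥ u r = if s = r then ((2 * k 0 : ℝ) : ℂ) else 0

/-- The two physical polarization states of a gluon of momentum `p`: transverse, `p · ε = 0`,
and orthonormal, `ε_s^* · ε_r = - δ_{sr}`. -/
structure IsPolarizationBasis (p : FourVec) (e : Fin 2 → Fin 4 → ℂ) : Prop where
  transverse : ∀ s, ∑ μ, (metricSign μ : ℂ) * (p μ : ℂ) * e s μ = 0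
  normalized : ∀ s r, ∑ μ, (metricSign μ : ℂ) * star (e s μ) * e r μ = if s = r then -1 else 0

/-- The external wave functions belong to the momenta `K`. -/
structure ExternalStates.IsFor (S : ExternalStates) (K : Momenta) (m₁ m₂ : ℝ) : Prop where
  spin₁ : IsSpinBasis K.k₁ m₁ S.u₁
  spin₂ : IsSpinBasis K.k₂ m₂ S.u₂
  gluon : IsPolarizationBasis K.p S.pol

/-- The boson-quark vertex `γ_μ (V - A γ₅)`. -/
def currentVertex (V A : ℝ) (μ : Fin 4) : Matrix (Fin 4) (Fin 4) ℂ :=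
  gammaLow μ * ((V : ℂ) • 1 - (A : ℂ) • gammaFive)

/-- The Dirac-matrix part of the sum of the two tree diagrams: the gluon, with (complex conjugated)
polarization `e`, is emitted from the outgoing or from the incoming quark. -/
def diracChain (V A m₁ m₂ : ℝ) (K : Momenta) (e : Fin 4 → ℂ) (μ : Fin 4) :
    Matrix (Fin 4) (Fin 4) ℂ :=
  (((mdot (K.k₂ + K.p) (K.k₂ + K.p) - m₂ ^ 2)⁻¹ : ℝ) : ℂ) •
      (slashC (star e) * (slash (K.k₂ + K.p) + (m₂ : ℂ) • 1) * currentVertex V A μ)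
  + (((mdot (K.k₁ - K.p) (K.k₁ - K.p) - m₁ ^ 2)⁻¹ : ℝ) : ℂ) •
      (currentVertex V A μ * (slash (K.k₁ - K.p) + (m₁ : ℂ) • 1) * slashC (star e))

/-- The amplitude `M_μ(V, A)`, the polarization vector of the boson being stripped off, for an
incoming quark with spin `s` and colour `i`, an outgoing quark with spin `r` and colour `j`, and a
gluon with polarization `h` and colour `a` (up to a constant phase, which drops out of the partonic
tensor). The row vector `ū = u† γ⁰` is `star u ᵥ* γ⁰`. -/
def amplitude (gs V A m₁ m₂ : ℝ) (K : Momenta) (S : ExternalStates)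
    (s r h : Fin 2) (i j : Fin 3) (a : Fin 8) (μ : Fin 4) : ℂ :=
  (gs : ℂ) * colorGen a j i *
    ((star (S.u₂ r) ᵥ* gammaUp 0) ⬝ᵥ (diracChain V A m₁ m₂ K (S.pol h) μ *ᵥ S.u₁ s))

/-- The partonic tensor `M_μ(V, A) (M_ν(V', A'))^*`, averaged over the spin and the colour of the
incoming quark and summed over all spins and colours of the final state. -/
def averagedTensor (gs : ℝ) (c : Couplings) (m₁ m₂ : ℝ) (K : Momenta) (S : ExternalStates)
    (μ ν : Fin 4) : ℂ :=
  (1 / 3) * ∑ i : Fin 3, ∑ j : Fin 3, ∑ a : Fin 8,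
    (1 / 2) * ∑ s : Fin 2, ∑ r : Fin 2, ∑ h : Fin 2,
      amplitude gs c.V c.A m₁ m₂ K S s r h i j a μ *
        star (amplitude gs c.Vp c.Ap m₁ m₂ K S s r h i j a ν)

/-! ### Projectors and partonic structure functions -/

/-- The triangle function `Δ(a, b, c)`. -/
def triangle (a b c : ℝ) : ℝ :=
  Real.sqrt (a ^ 2 + b ^ 2 + c ^ 2 - 2 * a * b - 2 * a * c - 2 * b * c)

/-- The four-dimensional projector `P₄^{μν}(P, q)`. -/
def projector₄ (P q : FourVec) (μ ν : Fin 4) : ℝ :=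
  let Q2 := -mdot q q
  let D := triangle (mdot (P + q) (P + q)) (mdot P P) (-Q2)
  2 * Q2 / D ^ 2 * (mdot P P * metricUp μ ν
    + 4 / D ^ 2 * ((D ^ 2 / 2 - 3 * mdot P P * Q2) * (P μ * P ν)
      + 3 * mdot P P ^ 2 * (q μ * q ν)
      - 3 * mdot P P * mdot P q * (P μ * q ν + q μ * P ν)))

/-- The four-dimensional projector `P₅^{μν}(P, q)`. -/
def projector₅ (P q : FourVec) (μ ν : Fin 4) : ℝ :=
  let Q2 := -mdot q q
  let D := triangle (mdot (P + q) (P + q)) (mdot P P) (-Q2)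
  (-(4 * mdot P q / D ^ 2)) * (-(12 / D ^ 2) * (Q2 * mdot P q * (P μ * P ν)
      - mdot P P * mdot P q * (q μ * q ν)
      + (D ^ 2 / 6 - Q2 * mdot P P) * (P μ * q ν + q μ * P ν))
    + mdot P q * metricUp μ ν)

/-- The partonic structure function `(C_F g_s² / 2)⁻¹ P^{μν}(k₁, q) W_{μν}`, where `W` is the
averaged partonic tensor and `P` is one of the two projectors. -/
def structureFunction (P : FourVec → FourVec → Fin 4 → Fin 4 → ℝ) (gs : ℝ) (c : Couplings)
    (m₁ m₂ : ℝ) (K : Momenta) (S : ExternalStates) : ℂ :=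
  ((casimirF * (gs ^ 2 / 2))⁻¹ : ℝ) *
    ∑ μ, ∑ ν, (P K.k₁ K.q μ ν : ℂ) * averagedTensor gs c m₁ m₂ K S μ ν

/-- The explicit expression for `F̂₄`. The last three arguments stand for the places at which
`1 / t̂₁²`, `1 / t̂₁` and `t̂₁` occur. -/
def explicitF₄ (c : Couplings) (m₁ m₂ Q2 s₁ tInvSq tInv t : ℝ) : ℝ :=
  let D := triangle (m₁ ^ 2) (m₂ ^ 2) (-Q2)
  let D' := triangle (m₁ ^ 2) (s₁ + m₂ ^ 2) (-Q2)
  let Spp := Q2 + m₂ ^ 2 + m₁ ^ 2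
  let Spm := Q2 + m₂ ^ 2 - m₁ ^ 2
  (-16) * (Q2 / D' ^ 4) *
    (c.qPlus *
      (2 * D ^ 2 * m₁ ^ 2 + Spp ^ 2 * (7 * m₁ ^ 2 + 2 * m₂ ^ 2 - Q2)
        + s₁ * (-2 * D ^ 2 + 14 * m₁ ^ 2 * Spp - Spm ^ 2)
        + 4 * D ^ 2 * m₂ ^ 2 * m₁ ^ 2 / s₁
        + s₁ ^ 2 * (2 * m₁ ^ 2 - 3 * Spm)
        + m₁ ^ 2 * s₁ * (11 * D ^ 2 + 36 * m₁ ^ 2 * m₂ ^ 2 - Spm * Spp) * tInv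
        + 4 * D ^ 2 * m₁ ^ 4 * s₁ * tInvSq
        + 4 * m₁ ^ 4 * s₁ ^ 2 * (2 * Spp - m₁ ^ 2) * tInvSq
        + 6 * m₂ ^ 2 * m₁ ^ 2 * Spp * t / s₁
        + 4 * m₁ ^ 2 * s₁ ^ 2 * (m₁ ^ 2 + 2 * Spp) * tInv
        + 4 * m₁ ^ 4 * s₁ ^ 3 * tInvSq
        + 2 * m₁ ^ 2 * s₁ ^ 3 * tInv
        - 3 * m₂ ^ 2 * Spm ^ 2
        + 4 * D ^ 2 * m₁ ^ 2 * Spp * tInv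
        + t * (Spp * (4 * m₁ ^ 2 - Spm) + 4 * m₁ ^ 2 * m₂ ^ 2)
        - 2 * s₁ * t * Spm - s₁ ^ 2 * t - s₁ ^ 3)
    - 2 * m₁ * m₂ * c.qMinus *
      (t * (D ^ 2 + 6 * m₁ ^ 2 * m₂ ^ 2) / s₁
        + 6 * m₁ ^ 2 * (m₁ ^ 2 * s₁ * tInv + s₁ + Spp)
        + t * (2 * (m₁ ^ 2 + Spp) + s₁)))

/-- The explicit expression for `F̂₅`. The last three arguments stand for the places at which
`1 / t̂₁²`, `1 / t̂₁` and `t̂₁` occur. -/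
def explicitF₅ (c : Couplings) (m₁ m₂ Q2 xhat s₁ tInvSq tInv t : ℝ) : ℝ :=
  let D := triangle (m₁ ^ 2) (m₂ ^ 2) (-Q2)
  let D' := triangle (m₁ ^ 2) (s₁ + m₂ ^ 2) (-Q2)
  let Spp := Q2 + m₂ ^ 2 + m₁ ^ 2
  let Spm := Q2 + m₂ ^ 2 - m₁ ^ 2
  let Smp := Q2 - m₂ ^ 2 + m₁ ^ 2
  (-8) * (Q2 / (xhat * D' ^ 4)) *
    (c.qPlus *
      (-2 * D' ^ 2 * (5 * m₁ ^ 2 + m₂ ^ 2 + 2 * Q2)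
        + t * (s₁ * (-7 * m₁ ^ 2 - m₂ ^ 2 - 3 * Q2) - 12 * m₁ ^ 2 * m₂ ^ 2 + s₁ ^ 2
          + Spp * (Smp - 4 * Spm))
        + 2 * D ^ 4 * m₂ ^ 2 / s₁ ^ 2
        + s₁ * (-3 * D ^ 2 - 28 * m₁ ^ 2 * m₂ ^ 2 - Smp * Spp - 6 * Spm ^ 2 + 12 * Spm * Spp)
        - Spm * Spp * (7 * Spp - 4 * m₂ ^ 2)
        + D ^ 2 * (13 * Spp - 2 * Q2)
        + 2 * D ^ 4 * Spp * tInv / s₁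
        + 2 * m₁ ^ 2 * s₁ ^ 3 * (Spm - 2 * m₁ ^ 2) * tInvSq
        + (4 * D ^ 2 * (2 * D ^ 2 - m₁ ^ 2 * Spp + 6 * m₁ ^ 2 * m₂ ^ 2)
          + s₁ ^ 2 * (-2 * D ^ 2 - 20 * m₁ ^ 2 * m₂ ^ 2 + 4 * Spm ^ 2 + 9 * Spm * Spp)) * tInv
        + (s₁ * (Spp * (9 * D ^ 2 - 2 * m₁ ^ 2 * Spm + 4 * Spm ^ 2) - 6 * D ^ 2 * m₁ ^ 2)
          + s₁ ^ 3 * (5 * Spm - 4 * m₁ ^ 2) + s₁ ^ 4) * tInv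
        + (D ^ 2 * (5 * D ^ 2 + 8 * m₁ ^ 2 * m₂ ^ 2 - 3 * Smp * Spp)
          + t * (D ^ 2 * Spp + 2 * m₂ ^ 2 * (D ^ 2 - 3 * Spm * Spp))) / s₁
        + (2 * D ^ 4 * m₁ ^ 2
          + 2 * m₁ ^ 2 * s₁ ^ 2 * (D ^ 2 + 2 * Spp * (Spm - m₁ ^ 2) + 4 * m₁ ^ 4)
          + 2 * D ^ 2 * m₁ ^ 2 * s₁ * (3 * Spp - 2 * m₁ ^ 2)) * tInvSq)
    + 2 * m₁ * m₂ * c.qMinus *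
      (2 * (3 * Spm * Spp - D ^ 2)
        + 6 * m₁ ^ 2 * s₁ * (s₁ + Spm) * tInv
        + 4 * s₁ * (-m₁ ^ 2 + s₁ + 2 * Spp + t)
        + 2 * t * (3 * m₂ ^ 2 + Spm)
        + t * (D ^ 2 - 3 * Smp * Spp) / s₁))

/-! ### Integration over the polar angle -/

/-- `K` is a physical momentum configuration with virtuality `Q2` and given `ŝ₁`, in the
centre-of-mass frame `k₁ + q = 0` (spatial parts), such that `y = (1 - cos θ) / 2` for the angle `θ`
between the spatial parts of `k₂` and `k₁`. -/
structure Momenta.IsCM (K : Momenta) (m₁ m₂ Q2 s₁ y : ℝ) : Prop where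
  physical : K.IsPhysical m₁ m₂
  virtuality : K.Qsq = Q2
  energy : K.s₁ m₂ = s₁
  frame : spatial (K.k₁ + K.q) = 0
  angle : y = (1 - Real.cos (InnerProductGeometry.angle (spatial K.k₂) (spatial K.k₁))) / 2

/-- The function `t̂₁(y) = ŝ₁ / (ŝ₁ + m₂²) Δ' (y - y₀)`, `y₀ = [1 + (Σ₊₊ + ŝ₁) / Δ'] / 2`. -/
def tOfY (m₁ m₂ Q2 s₁ y : ℝ) : ℝ :=
  let D' := triangle (m₁ ^ 2) (s₁ + m₂ ^ 2) (-Q2)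
  let Spp := Q2 + m₂ ^ 2 + m₁ ^ 2
  let y₀ := (1 + (Spp + s₁) / D') / 2
  s₁ / (s₁ + m₂ ^ 2) * D' * (y - y₀)

/-- The logarithm `ln [(Σ₊₊ + ŝ₁ - Δ') / (Σ₊₊ + ŝ₁ + Δ')]`. -/
def logTerm (m₁ m₂ Q2 s₁ : ℝ) : ℝ :=
  let D' := triangle (m₁ ^ 2) (s₁ + m₂ ^ 2) (-Q2)
  let Spp := Q2 + m₂ ^ 2 + m₁ ^ 2
  Real.log ((Spp + s₁ - D') / (Spp + s₁ + D'))

/-- What is substituted for `1 / t̂₁²`. -/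
def substInvSq (m₁ m₂ s₁ : ℝ) : ℝ := (s₁ + m₂ ^ 2) / (m₁ ^ 2 * s₁ ^ 2)

/-- What is substituted for `1 / t̂₁`. -/
def substInv (m₁ m₂ Q2 s₁ : ℝ) : ℝ :=
  (s₁ + m₂ ^ 2) / (s₁ * triangle (m₁ ^ 2) (s₁ + m₂ ^ 2) (-Q2)) * logTerm m₁ m₂ Q2 s₁

/-- What is substituted for `t̂₁`. -/
def substT (m₁ m₂ Q2 s₁ : ℝ) : ℝ :=
  -(s₁ * (Q2 + m₂ ^ 2 + m₁ ^ 2 + s₁) / (2 * (s₁ + m₂ ^ 2)))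

end QuarkScattering

end

open QuarkScattering

/-!
The structure functions are evaluated as Feynman diagrams are by hand, every step being a finite
identity for `4 × 4` matrices.

*Sums over states.* The spin sum `∑ u ū = k̸ + m` (`IsSpinBasis.sum_vecMulVec`) holds because both
sides, multiplied by `γ⁰ / (2 k⁰)`, are Hermitian projections of the same trace with one range
inside the other. The sum of the two diagrams vanishes when the gluon polarization is replaced by
the gluon momentum (`dotProduct_emission_slash`), so that the sum over two physical polarizations
may be replaced by `-g_{ρσ}` (`IsPolarizationBasis.sum_eq`). Together with the colour sum
`Tr T^a T^a = 4` this turns a structure function into a contracted Dirac trace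
(`structureFunction_eq`).

*Elimination of `γ₅`.* All momenta lie in a three-dimensional space that contains the timelike
vector `k₁ + q`, so there is a spacelike `n` orthogonal to them. The reflection along `n` fixes all
momenta and the metric, and lifts to an automorphism of the Dirac algebra that changes the sign of
`γ₅`; hence terms with a single `γ₅` have no contraction with the projectors
(`project_tensor_eq_zero`). In the term with two of them, both `γ₅` are moved through the incoming
quark line, which only reverses the sign of `m₁` (`tensor_gammaFive`). The axial contribution is
therefore the vector contribution at `-m₁`; this is why the result depends on the couplings through
`q₊` and `m₁ m₂ q₋`.

*Vector currents.* The contraction identities for `γ_ρ ⋯ γ^ρ` and the traces of up to six slashed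
vectors give the vector contribution as a polynomial in Minkowski products (`tensor_one_one`,
`metricTrace_tensor`), all of which are affine functions of `m₁²`, `m₂²`, `Q²`, `ŝ₁`, `t̂₁`
(`Momenta.IsPhysical.hasInvariants`). Comparison with the stated expressions is then an identity of
rational functions (`projectHadron₄`, `projectHadron₅`).

*Inclusive part.* In the centre-of-mass frame `t̂₁` is affine in `y` and negative on `[0, 1]`
(`Momenta.IsCM.t₁_eq`, `tOfY_neg`), the three integrals are elementary, and the semi-inclusive
expressions are affine in `1 / t̂₁²`, `1 / t̂₁`, `t̂₁`, so they may be integrated by substitution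
(`integral_affine`).
-/

noncomputable section

namespace QuarkScattering

/-! ### Dirac algebra -/

theorem slashC_eq (v : Fin 4 → ℂ) :
    slashC v = !![v 0, 0, -v 3, -v 1 + Complex.I * v 2;
      0, v 0, -v 1 - Complex.I * v 2, v 3;
      v 3, v 1 - Complex.I * v 2, -v 0, 0;
      v 1 + Complex.I * v 2, -v 3, 0, -v 0] := by
  ext i j
  fin_cases i <;> fin_cases j <;>
    simp [slashC, Fin.sum_univ_four, gammaLow, gammaUp, metricSign, Matrix.sum_apply] <;> ring

theorem gammaFive_eq :
    gammaFive = !![0, 0, 1, 0; 0, 0, 0, 1; 1, 0, 0, 0; 0, 1, 0, 0] := by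
  ext i j
  fin_cases i <;> fin_cases j <;>
    simp [gammaFive, gammaUp]

theorem mdot_eq (a b : FourVec) :
    mdot a b = a 0 * b 0 - a 1 * b 1 - a 2 * b 2 - a 3 * b 3 := by
  simp [mdot, Fin.sum_univ_four, metricSign]; ring

theorem mdot_comm (a b : FourVec) : mdot a b = mdot b a := by
  simp only [mdot_eq]; ring

theorem mdot_add_left (a b c : FourVec) : mdot (a + b) c = mdot a c + mdot b c := by
  simp only [mdot_eq, Pi.add_apply]; ring

theorem mdot_add_right (a b c : FourVec) : mdot a (b + c) = mdot a b + mdot a c := by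
  simp only [mdot_eq, Pi.add_apply]; ring

theorem mdot_sub_left (a b c : FourVec) : mdot (a - b) c = mdot a c - mdot b c := by
  simp only [mdot_eq, Pi.sub_apply]; ring

theorem mdot_sub_right (a b c : FourVec) : mdot a (b - c) = mdot a b - mdot a c := by
  simp only [mdot_eq, Pi.sub_apply]; ring

theorem slashC_add (v w : Fin 4 → ℂ) : slashC (v + w) = slashC v + slashC w := by
  simp [slashC, add_smul, Finset.sum_add_distrib]

theorem slashC_smul (z : ℂ) (v : Fin 4 → ℂ) : slashC (z • v) = z • slashC v := by
  simp [slashC, Finset.smul_sum, smul_smul]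

theorem slash_add (a b : FourVec) : slash (a + b) = slash a + slash b := by
  simp only [slash]; rw [← slashC_add]; congr 1; ext; simp

theorem slash_smul (x : ℝ) (a : FourVec) : slash (x • a) = (x : ℂ) • slash a := by
  simp only [slash]; rw [← slashC_smul]; congr 1; ext; simp

theorem slash_sub (a b : FourVec) : slash (a - b) = slash a - slash b := by
  have h := slash_add (a - b) b
  rw [sub_add_cancel] at h
  rw [h, add_sub_cancel_right]

theorem gammaLow_eq_slash (μ : Fin 4) : gammaLow μ = slash (Pi.single μ 1) := by
  simp [slash, slashC, Pi.single_apply]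

theorem slash_eq_sum (a : FourVec) : slash a = ∑ μ, (a μ : ℂ) • gammaLow μ := rfl

/-- The Clifford relation. -/
theorem slash_mul_slash (a b : FourVec) :
    slash a * slash b = ((2 * mdot a b : ℝ) : ℂ) • 1 - slash b * slash a := by
  rw [eq_sub_iff_add_eq]
  simp only [slash, slashC_eq, mdot_eq]
  ext i j
  fin_cases i <;> fin_cases j <;>
    simp <;> ring_nf <;> simp only [Complex.I_sq] <;> ring

theorem slash_mul_self (a : FourVec) : slash a * slash a = (mdot a a : ℂ) • 1 := by
  have h := slash_mul_slash a a
  rw [eq_sub_iff_add_eq, ← two_smul ℂ (slash a * slash a)] at h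
  have h2 : (2 : ℂ) • (slash a * slash a) = (2 : ℂ) • ((mdot a a : ℂ) • 1) := by
    rw [h, smul_smul]; push_cast; rfl
  exact smul_right_injective _ (two_ne_zero : (2 : ℂ) ≠ 0) h2

theorem gammaFive_mul_self : gammaFive * gammaFive = 1 := by
  rw [gammaFive_eq]
  ext i j
  fin_cases i <;> fin_cases j <;> simp [Matrix.mul_apply, Fin.sum_univ_four]

theorem gammaFive_mul_slash (a : FourVec) : gammaFive * slash a = -(slash a * gammaFive) := by
  rw [gammaFive_eq, slash, slashC_eq]
  ext i j
  fin_cases i <;> fin_cases j <;> simp [Matrix.mul_apply, Fin.sum_univ_four] <;> ring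

theorem gammaFive_conjTranspose : gammaFiveᴴ = gammaFive := by
  rw [gammaFive_eq]
  ext i j
  fin_cases i <;> fin_cases j <;> simp [Matrix.conjTranspose_apply]

theorem gammaUp_zero_mul_self : gammaUp 0 * gammaUp 0 = 1 := by
  ext i j
  fin_cases i <;> fin_cases j <;> simp [gammaUp, Matrix.mul_apply, Fin.sum_univ_four]

theorem gammaUp_zero_conjTranspose : (gammaUp 0)ᴴ = gammaUp 0 := by
  ext i j
  fin_cases i <;> fin_cases j <;> simp [gammaUp, Matrix.conjTranspose_apply]

theorem gammaUp_zero_eq_slash : gammaUp 0 = slash (Pi.single 0 1) := by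
  rw [← gammaLow_eq_slash]; simp [gammaLow, metricSign]

/-- The Dirac adjoint `M̄ = γ⁰ M† γ⁰` of a matrix. -/
def diracBar (M : Matrix (Fin 4) (Fin 4) ℂ) : Matrix (Fin 4) (Fin 4) ℂ :=
  gammaUp 0 * Mᴴ * gammaUp 0

theorem diracBar_mul (M N : Matrix (Fin 4) (Fin 4) ℂ) :
    diracBar (M * N) = diracBar N * diracBar M := by
  simp only [diracBar, conjTranspose_mul]
  calc gammaUp 0 * (Nᴴ * Mᴴ) * gammaUp 0
      = gammaUp 0 * Nᴴ * 1 * Mᴴ * gammaUp 0 := by simp only [Matrix.mul_assoc, Matrix.one_mul]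
    _ = _ := by rw [← gammaUp_zero_mul_self]; simp only [Matrix.mul_assoc]

theorem diracBar_add (M N : Matrix (Fin 4) (Fin 4) ℂ) :
    diracBar (M + N) = diracBar M + diracBar N := by
  simp [diracBar, Matrix.mul_add, Matrix.add_mul]

theorem diracBar_sub (M N : Matrix (Fin 4) (Fin 4) ℂ) :
    diracBar (M - N) = diracBar M - diracBar N := by
  simp [diracBar, Matrix.mul_sub, Matrix.sub_mul]

theorem diracBar_smul (z : ℂ) (M : Matrix (Fin 4) (Fin 4) ℂ) :
    diracBar (z • M) = star z • diracBar M := by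
  simp [diracBar, Matrix.conjTranspose_smul]

theorem diracBar_one : diracBar 1 = 1 := by
  simp [diracBar, gammaUp_zero_mul_self]

theorem diracBar_slash (a : FourVec) : diracBar (slash a) = slash a := by
  simp only [diracBar, slash, slashC_eq]
  ext i j
  rw [Matrix.mul_apply]
  simp only [Matrix.mul_apply, conjTranspose_apply, Fin.sum_univ_four]
  fin_cases i <;> fin_cases j <;> simp [gammaUp] <;> ring

theorem diracBar_gammaLow (μ : Fin 4) : diracBar (gammaLow μ) = gammaLow μ := by
  rw [gammaLow_eq_slash, diracBar_slash]

theorem diracBar_gammaFive : diracBar gammaFive = -gammaFive := by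
  rw [diracBar, gammaFive_conjTranspose, gammaUp_zero_eq_slash, Matrix.mul_assoc,
    gammaFive_mul_slash, Matrix.mul_neg, ← Matrix.mul_assoc, slash_mul_self]
  simp [mdot_eq]

/-! ### Traces of products of slashed vectors -/

theorem trace_eq_zero_of_anticommute {X : Matrix (Fin 4) (Fin 4) ℂ}
    (h : gammaFive * X = -(X * gammaFive)) : trace X = 0 := by
  have h1 : trace X = -trace X := by
    calc trace X = trace (gammaFive * (gammaFive * X)) := by
          rw [← Matrix.mul_assoc, gammaFive_mul_self, Matrix.one_mul]
      _ = -trace (gammaFive * (X * gammaFive)) := by rw [h, Matrix.mul_neg, trace_neg]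
      _ = -trace X := by
          rw [trace_mul_comm, Matrix.mul_assoc, gammaFive_mul_self, Matrix.mul_one]
  linear_combination h1 / 2

theorem trace_slash (a : FourVec) : trace (slash a) = 0 :=
  trace_eq_zero_of_anticommute (gammaFive_mul_slash a)

theorem gammaFive_mul_slash_mul (a : FourVec) (X : Matrix (Fin 4) (Fin 4) ℂ) :
    gammaFive * (slash a * X) = -(slash a * (gammaFive * X)) := by
  rw [← Matrix.mul_assoc, gammaFive_mul_slash, Matrix.neg_mul, Matrix.mul_assoc]

theorem trace_slash₃ (a b c : FourVec) : trace (slash a * (slash b * slash c)) = 0 := by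
  apply trace_eq_zero_of_anticommute
  simp only [gammaFive_mul_slash_mul, gammaFive_mul_slash, Matrix.mul_neg, Matrix.mul_assoc,
    neg_neg]

theorem trace_slash₅ (a b c d e : FourVec) :
    trace (slash a * (slash b * (slash c * (slash d * slash e)))) = 0 := by
  apply trace_eq_zero_of_anticommute
  simp only [gammaFive_mul_slash_mul, gammaFive_mul_slash, Matrix.mul_neg, Matrix.mul_assoc,
    neg_neg]

theorem slash_mul_slash_mul (a b : FourVec) (X : Matrix (Fin 4) (Fin 4) ℂ) :
    slash a * (slash b * X) = ((2 * mdot a b : ℝ) : ℂ) • X - slash b * (slash a * X) := by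
  rw [← Matrix.mul_assoc, slash_mul_slash, Matrix.sub_mul, Matrix.smul_mul, Matrix.one_mul,
    Matrix.mul_assoc]

theorem trace_slash₂ (a b : FourVec) : trace (slash a * slash b) = 4 * (mdot a b : ℂ) := by
  have h : trace (slash a * slash b)
      = trace (((2 * mdot a b : ℝ) : ℂ) • 1 - slash b * slash a) := by
    rw [slash_mul_slash]
  rw [trace_sub, trace_smul, trace_one, trace_mul_comm (slash b)] at h
  simp at h
  linear_combination h / 2

theorem trace_slash₄ (a b c d : FourVec) :
    trace (slash a * (slash b * (slash c * slash d))) =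
      4 * (mdot a b * mdot c d - mdot a c * mdot b d + mdot a d * mdot b c : ℂ) := by
  have h : trace (slash a * (slash b * (slash c * slash d))) =
      2 * mdot a b * trace (slash c * slash d) - 2 * mdot a c * trace (slash b * slash d)
        + 2 * mdot a d * trace (slash b * slash c)
        - trace (slash b * (slash c * (slash d * slash a))) := by
    rw [slash_mul_slash_mul a b, slash_mul_slash_mul a c, slash_mul_slash a d]
    simp only [Matrix.mul_sub, Matrix.mul_smul, trace_sub, trace_smul, smul_eq_mul, Matrix.mul_one]
    push_cast; ring
  have hc : trace (slash b * (slash c * (slash d * slash a))) =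
      trace (slash a * (slash b * (slash c * slash d))) := by
    rw [trace_mul_comm (slash a)]; simp only [Matrix.mul_assoc]
  rw [hc] at h
  simp only [trace_slash₂] at h
  linear_combination h / 2

theorem trace_slash₆ (a b c d e f : FourVec) :
    trace (slash a * (slash b * (slash c * (slash d * (slash e * slash f))))) =
      4 * (mdot a b * (mdot c d * mdot e f - mdot c e * mdot d f + mdot c f * mdot d e)
        - mdot a c * (mdot b d * mdot e f - mdot b e * mdot d f + mdot b f * mdot d e)
        + mdot a d * (mdot b c * mdot e f - mdot b e * mdot c f + mdot b f * mdot c e)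
        - mdot a e * (mdot b c * mdot d f - mdot b d * mdot c f + mdot b f * mdot c d)
        + mdot a f * (mdot b c * mdot d e - mdot b d * mdot c e + mdot b e * mdot c d) : ℂ) := by
  have h : trace (slash a * (slash b * (slash c * (slash d * (slash e * slash f))))) =
      2 * mdot a b * trace (slash c * (slash d * (slash e * slash f)))
        - 2 * mdot a c * trace (slash b * (slash d * (slash e * slash f)))
        + 2 * mdot a d * trace (slash b * (slash c * (slash e * slash f)))
        - 2 * mdot a e * trace (slash b * (slash c * (slash d * slash f)))
        + 2 * mdot a f * trace (slash b * (slash c * (slash d * slash e)))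
        - trace (slash b * (slash c * (slash d * (slash e * (slash f * slash a))))) := by
    rw [slash_mul_slash_mul a b, slash_mul_slash_mul a c, slash_mul_slash_mul a d,
      slash_mul_slash_mul a e, slash_mul_slash a f]
    simp only [Matrix.mul_sub, Matrix.mul_smul, trace_sub, trace_smul, smul_eq_mul, Matrix.mul_one]
    push_cast; ring
  have hc : trace (slash b * (slash c * (slash d * (slash e * (slash f * slash a))))) =
      trace (slash a * (slash b * (slash c * (slash d * (slash e * slash f))))) := by
    rw [trace_mul_comm (slash a)]; simp only [Matrix.mul_assoc]
  rw [hc] at h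
  simp only [trace_slash₄] at h
  linear_combination h / 2

/-! ### Contraction of a pair of Dirac matrices -/

/-- The contraction `γ_ρ X γ^ρ`. -/
def contract (X : Matrix (Fin 4) (Fin 4) ℂ) : Matrix (Fin 4) (Fin 4) ℂ :=
  ∑ ρ, (metricSign ρ : ℂ) • (gammaLow ρ * X * gammaLow ρ)

theorem slash_eq_sum_mdot (a : FourVec) :
    slash a = ∑ ρ, ((metricSign ρ * mdot (Pi.single ρ 1) a : ℝ) : ℂ) • gammaLow ρ := by
  rw [slash_eq_sum]
  refine Finset.sum_congr rfl fun ρ _ => ?_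
  congr 2
  fin_cases ρ <;> simp [mdot_eq, metricSign]

theorem contract_one : contract 1 = (4 : ℂ) • 1 := by
  simp only [contract, Matrix.mul_one, gammaLow_eq_slash, slash_mul_self]
  rw [Fin.sum_univ_four]
  simp [mdot_eq, metricSign]
  module

theorem contract_add (X Y : Matrix (Fin 4) (Fin 4) ℂ) :
    contract (X + Y) = contract X + contract Y := by
  simp [contract, Matrix.mul_add, Matrix.add_mul, Finset.sum_add_distrib]

theorem contract_smul (z : ℂ) (X : Matrix (Fin 4) (Fin 4) ℂ) :
    contract (z • X) = z • contract X := by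
  simp [contract, Finset.smul_sum, smul_comm z]

theorem contract_slash_mul (a : FourVec) (X : Matrix (Fin 4) (Fin 4) ℂ) :
    contract (slash a * X) = (2 : ℂ) • (X * slash a) - slash a * contract X := by
  simp only [contract]
  have h : ∀ ρ, gammaLow ρ * (slash a * X) * gammaLow ρ =
      ((2 * mdot (Pi.single ρ 1) a : ℝ) : ℂ) • (X * gammaLow ρ)
        - slash a * (gammaLow ρ * X * gammaLow ρ) := by
    intro ρ
    rw [gammaLow_eq_slash, slash_mul_slash_mul, Matrix.sub_mul, Matrix.smul_mul]
    simp only [Matrix.mul_assoc]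
  simp only [h, smul_sub, Finset.sum_sub_distrib]
  congr 1
  · rw [slash_eq_sum_mdot a, Matrix.mul_sum, Finset.smul_sum]
    refine Finset.sum_congr rfl fun ρ _ => ?_
    rw [Matrix.mul_smul, smul_smul, smul_smul]
    congr 1; push_cast; ring
  · rw [Matrix.mul_sum]
    refine Finset.sum_congr rfl fun ρ _ => ?_
    rw [Matrix.mul_smul]

theorem contract_slash (a : FourVec) : contract (slash a) = (-2 : ℂ) • slash a := by
  have h := contract_slash_mul a 1
  rw [Matrix.mul_one, Matrix.one_mul, contract_one] at h
  rw [h, Matrix.mul_smul, Matrix.mul_one]; module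

theorem contract_slash₂ (a b : FourVec) :
    contract (slash a * slash b) = ((4 * mdot a b : ℝ) : ℂ) • 1 := by
  rw [contract_slash_mul, contract_slash, Matrix.mul_smul, slash_mul_slash a b]
  push_cast; module

theorem contract_slash₃ (a b c : FourVec) :
    contract (slash a * (slash b * slash c)) = (-2 : ℂ) • (slash c * (slash b * slash a)) := by
  rw [contract_slash_mul, contract_slash₂, slash_mul_slash b c, Matrix.mul_smul, Matrix.mul_one,
    Matrix.sub_mul, Matrix.smul_mul, Matrix.one_mul, Matrix.mul_assoc]
  push_cast; module

/-! ### Spin sums -/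

theorem gammaUp_zero_mul_slash (k : FourVec) :
    gammaUp 0 * slash k = ((2 * k 0 : ℝ) : ℂ) • 1 - slash k * gammaUp 0 := by
  rw [gammaUp_zero_eq_slash, slash_mul_slash]
  simp [mdot_eq]

theorem slash_conjTranspose (k : FourVec) : (slash k)ᴴ = gammaUp 0 * slash k * gammaUp 0 := by
  have h := diracBar_slash k
  rw [diracBar] at h
  calc (slash k)ᴴ = gammaUp 0 * gammaUp 0 * (slash k)ᴴ * (gammaUp 0 * gammaUp 0) := by
        rw [gammaUp_zero_mul_self, Matrix.one_mul, Matrix.mul_one]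
    _ = gammaUp 0 * (gammaUp 0 * (slash k)ᴴ * gammaUp 0) * gammaUp 0 := by
        simp only [Matrix.mul_assoc]
    _ = _ := by rw [h]

open scoped ComplexOrder in
/-- The spin sum `∑ u u† = (k^μ γ_μ + m) γ⁰`. Divided by `2 k⁰`, both sides are Hermitian
projections of trace `2`, and the range of the left one is contained in the range of the right
one; so their difference is a Hermitian projection of trace zero. -/
theorem IsSpinBasis.sum_vecMulVec {k : FourVec} {m : ℝ} {u : Fin 2 → Fin 4 → ℂ}
    (h : IsSpinBasis k m u) (hk : 0 < k 0) (hs : mdot k k = m ^ 2) :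
    ∑ s, vecMulVec (u s) (star (u s)) = (slash k + (m : ℂ) • 1) * gammaUp 0 := by
  set A := (slash k + (m : ℂ) • 1) * gammaUp 0 with hA
  set R := ∑ s, vecMulVec (u s) (star (u s)) with hR
  set c : ℂ := ((2 * k 0 : ℝ) : ℂ) with hc
  have hkk : slash k * slash k = ((m : ℂ) * m) • 1 := by
    rw [slash_mul_self, hs]; push_cast; rw [sq]
  have hcomm : A = c • 1 - gammaUp 0 * slash k + (m : ℂ) • gammaUp 0 := by
    rw [hA, gammaUp_zero_mul_slash, Matrix.add_mul, Matrix.smul_mul, Matrix.one_mul]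
    abel
  have hAA : A * A = c • A := by
    have h0 : (slash k - (m : ℂ) • 1) * A = 0 := by
      rw [hA, ← Matrix.mul_assoc]
      have : (slash k - (m : ℂ) • 1) * (slash k + (m : ℂ) • 1) = 0 := by
        simp only [Matrix.sub_mul, Matrix.mul_add, hkk, Matrix.smul_mul, Matrix.mul_smul,
          Matrix.one_mul, Matrix.mul_one]
        module
      rw [this, Matrix.zero_mul]
    calc A * A = c • A - gammaUp 0 * ((slash k - (m : ℂ) • 1) * A) := by
          nth_rw 1 [hcomm]
          simp only [Matrix.add_mul, Matrix.sub_mul, Matrix.smul_mul, Matrix.one_mul,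
            Matrix.mul_sub, Matrix.mul_smul, Matrix.mul_assoc]
          abel
      _ = c • A := by rw [h0, Matrix.mul_zero, sub_zero]
  have hAu : ∀ s, A *ᵥ u s = c • u s := by
    intro s
    rw [hcomm, add_mulVec, sub_mulVec, smul_mulVec, one_mulVec, ← mulVec_mulVec, h.dirac s,
      mulVec_smul, smul_mulVec]
    abel
  have hAR : A * R = c • R := by
    rw [hR, Matrix.mul_sum, Finset.smul_sum]
    refine Finset.sum_congr rfl fun s _ => ?_
    rw [mul_vecMulVec, hAu, smul_vecMulVec]
  have hRH : Rᴴ = R := by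
    rw [hR, conjTranspose_sum]
    refine Finset.sum_congr rfl fun s _ => ?_
    rw [conjTranspose_vecMulVec, star_star]
  have hAH : Aᴴ = A := by
    rw [hA, conjTranspose_mul, conjTranspose_add, slash_conjTranspose, gammaUp_zero_conjTranspose,
      conjTranspose_smul, conjTranspose_one, Matrix.mul_add, ← Matrix.mul_assoc,
      ← Matrix.mul_assoc, gammaUp_zero_mul_self, Matrix.one_mul, Matrix.add_mul]
    simp
  have hRA : R * A = c • R := by
    have := congrArg conjTranspose hAR
    rw [conjTranspose_mul, hAH, hRH, conjTranspose_smul, hRH] at this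
    rw [this, hc]; simp
  have hRR : R * R = c • R := by
    nth_rw 1 [hR]
    rw [Matrix.sum_mul]
    conv_rhs => rw [hR, Finset.smul_sum]
    refine Finset.sum_congr rfl fun s _ => ?_
    rw [vecMulVec_mul, ← vecMulVec_smul]
    congr 1
    have h1 : ∀ r, star (u s) ᵥ* vecMulVec (u r) (star (u r))
        = (if s = r then c else 0) • star (u r) := by
      intro r
      rw [vecMul_vecMulVec, h.normalized]
    rw [hR, Matrix.vecMul_sum]
    simp only [h1]
    fin_cases s <;> simp
  have htA : trace A = 2 * c := by
    rw [hA, Matrix.add_mul, trace_add, Matrix.smul_mul, Matrix.one_mul, trace_smul,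
      gammaUp_zero_eq_slash, trace_slash₂, trace_slash, hc]
    simp [mdot_eq]; ring
  have htR : trace R = 2 * c := by
    rw [hR, trace_sum]
    simp only [trace_vecMulVec]
    have : ∀ s, u s ⬝ᵥ star (u s) = c := by
      intro s; rw [dotProduct_comm, h.normalized]; simp [hc]
    simp [this]
  -- `A - R` is Hermitian, and `Tr (A - R)² = c Tr (A - R) = 0`.
  have hX : A - R = 0 := by
    rw [← trace_conjTranspose_mul_self_eq_zero_iff, conjTranspose_sub, hAH, hRH]
    rw [Matrix.sub_mul, Matrix.mul_sub, Matrix.mul_sub, hAA, hAR, hRA, hRR]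
    simp only [trace_sub, trace_smul, htA, htR, sub_self, smul_eq_mul]
    simp
  rw [sub_eq_zero] at hX
  exact hX.symm

theorem IsSpinBasis.vecMul_slash {k : FourVec} {m : ℝ} {u : Fin 2 → Fin 4 → ℂ}
    (h : IsSpinBasis k m u) (s : Fin 2) :
    (star (u s) ᵥ* gammaUp 0) ᵥ* slash k = (m : ℂ) • (star (u s) ᵥ* gammaUp 0) := by
  have h1 := congrArg star (h.dirac s)
  rw [star_mulVec, star_smul, slash_conjTranspose] at h1
  have h2 := congrArg (fun v => v ᵥ* gammaUp 0) h1
  simp only [vecMul_vecMul, smul_vecMul] at h2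
  rw [Matrix.mul_assoc, gammaUp_zero_mul_self, Matrix.mul_one] at h2
  rw [vecMul_vecMul, h2]; simp

theorem trace_vecMulVec_mul {n : Type*} [Fintype n] (w w' u u' : n → ℂ) (A B : Matrix n n ℂ) :
    trace (vecMulVec w w' * A * (vecMulVec u u' * B)) = (w' ⬝ᵥ A *ᵥ u) * (u' ⬝ᵥ B *ᵥ w) := by
  rw [vecMulVec_mul, vecMulVec_mul _ u', vecMulVec_mul_vecMulVec, vecMulVec_smul, trace_smul,
    trace_vecMulVec,
    smul_eq_mul, ← dotProduct_mulVec, dotProduct_comm w, ← dotProduct_mulVec]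

/-- Casimir's trick: the spin sum of a product of two amplitudes is a trace. -/
theorem sum_spin_eq_trace {k₁ k₂ : FourVec} {m₁ m₂ : ℝ} {u₁ u₂ : Fin 2 → Fin 4 → ℂ}
    (h₁ : IsSpinBasis k₁ m₁ u₁) (h₂ : IsSpinBasis k₂ m₂ u₂) (he₁ : 0 < k₁ 0) (he₂ : 0 < k₂ 0)
    (hs₁ : mdot k₁ k₁ = m₁ ^ 2) (hs₂ : mdot k₂ k₂ = m₂ ^ 2) (X Y : Matrix (Fin 4) (Fin 4) ℂ) :
    ∑ s, ∑ r, ((star (u₂ r) ᵥ* gammaUp 0) ⬝ᵥ (X *ᵥ u₁ s)) *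
        star ((star (u₂ r) ᵥ* gammaUp 0) ⬝ᵥ (Y *ᵥ u₁ s)) =
      trace ((slash k₂ + (m₂ : ℂ) • 1) * X * ((slash k₁ + (m₁ : ℂ) • 1) * diracBar Y)) := by
  have h : ∀ s r, ((star (u₂ r) ᵥ* gammaUp 0) ⬝ᵥ (X *ᵥ u₁ s)) *
      star ((star (u₂ r) ᵥ* gammaUp 0) ⬝ᵥ (Y *ᵥ u₁ s)) =
      trace (vecMulVec (u₂ r) (star (u₂ r)) * (gammaUp 0 * X) *
        (vecMulVec (u₁ s) (star (u₁ s)) * (gammaUp 0 * Y)ᴴ)) := by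
    intro s r
    rw [trace_vecMulVec_mul, ← dotProduct_mulVec, ← dotProduct_mulVec, mulVec_mulVec,
      mulVec_mulVec]
    congr 1
    rw [← star_dotProduct_star, star_star, dotProduct_comm, star_mulVec, dotProduct_mulVec,
      dotProduct_comm]
  simp only [h]
  have h3 : ∑ s, ∑ r, trace (vecMulVec (u₂ r) (star (u₂ r)) * (gammaUp 0 * X) *
        (vecMulVec (u₁ s) (star (u₁ s)) * (gammaUp 0 * Y)ᴴ)) =
      trace ((∑ r, vecMulVec (u₂ r) (star (u₂ r))) * (gammaUp 0 * X) *
        ((∑ s, vecMulVec (u₁ s) (star (u₁ s))) * (gammaUp 0 * Y)ᴴ)) := by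
    simp only [Matrix.sum_mul, Matrix.mul_sum, trace_sum]
  rw [h3, h₁.sum_vecMulVec he₁ hs₁, h₂.sum_vecMulVec he₂ hs₂, diracBar, conjTranspose_mul,
    gammaUp_zero_conjTranspose]
  congr 2
  · rw [Matrix.mul_assoc, ← Matrix.mul_assoc (gammaUp 0), gammaUp_zero_mul_self, Matrix.one_mul]
  · simp only [Matrix.mul_assoc]

/-! ### Polarization sum -/

/-- The polarization sum `∑ ε_ρ^* ε_σ → -g_{ρσ}` between conserved currents. Shifting the
polarization vectors by multiples of `p` makes them purely spatial; together with the time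
direction and the direction of the spatial momentum they then form a unitary matrix. -/
theorem IsPolarizationBasis.sum_eq {p : FourVec} {e : Fin 2 → Fin 4 → ℂ}
    (h : IsPolarizationBasis p e) (hp : 0 < p 0) (hs : mdot p p = 0) {a b : Fin 4 → ℂ}
    (ha : ∑ ρ, (p ρ : ℂ) * a ρ = 0) (hb : ∑ ρ, (p ρ : ℂ) * b ρ = 0) :
    ∑ i, (∑ ρ, star (e i ρ) * a ρ) * star (∑ ρ, star (e i ρ) * b ρ) =
      -∑ ρ, (metricSign ρ : ℂ) * (a ρ * star (b ρ)) := by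
  have hp0 : (p 0 : ℂ) ≠ 0 := by exact_mod_cast hp.ne'
  have hsC : (p 0 : ℂ) * p 0 - p 1 * p 1 - p 2 * p 2 - p 3 * p 3 = 0 := by
    rw [mdot_eq] at hs; exact_mod_cast hs
  set f : Fin 2 → Fin 4 → ℂ := fun i ρ => e i ρ - e i 0 / p 0 * p ρ with hf
  have htr : ∀ i, (p 0 : ℂ) * e i 0 - p 1 * e i 1 - p 2 * e i 2 - p 3 * e i 3 = 0 := by
    intro i
    have := h.transverse i
    simp [Fin.sum_univ_four, metricSign] at this
    linear_combination this
  have htrs : ∀ i, (p 0 : ℂ) * star (e i 0) - p 1 * star (e i 1) - p 2 * star (e i 2)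
      - p 3 * star (e i 3) = 0 := by
    intro i
    have := congrArg star (htr i)
    simpa using this
  have hn : ∀ i j, star (e i 0) * e j 0 - star (e i 1) * e j 1 - star (e i 2) * e j 2
      - star (e i 3) * e j 3 = if i = j then -1 else 0 := by
    intro i j
    rw [← h.normalized i j]
    simp [Fin.sum_univ_four, metricSign]; ring
  have hf0 : ∀ i, f i 0 = 0 := by intro i; simp [hf, hp0]
  have hfs : ∀ i ρ, star (f i ρ) = star (e i ρ) - star (e i 0) / p 0 * p ρ := by
    intro i ρ; simp [hf]
  have hfn : ∀ i j, f i 1 * star (f j 1) + f i 2 * star (f j 2) + f i 3 * star (f j 3)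
      = if i = j then 1 else 0 := by
    intro i j
    have h1 := hn j i
    have h2 := htr i
    have h3 := htrs j
    have h4 : (if i = j then (1 : ℂ) else 0) = -(if j = i then (-1 : ℂ) else 0) := by
      by_cases hij : i = j
      · simp [hij]
      · simp [hij, Ne.symm hij]
    rw [h4, ← h1]
    simp only [hfs]
    simp only [hf]
    field_simp
    linear_combination (-e i 0 * star (e j 0)) * hsC + (p 0 : ℂ) * star (e j 0) * h2
      + (p 0 : ℂ) * e i 0 * h3
  have hfp : ∀ i, f i 1 * p 1 + f i 2 * p 2 + f i 3 * p 3 = 0 := by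
    intro i
    simp only [hf]
    field_simp
    linear_combination -(p 0 : ℂ) * htr i + e i 0 * hsC
  have hfps : ∀ i, p 1 * star (f i 1) + p 2 * star (f i 2) + p 3 * star (f i 3) = 0 := by
    intro i
    have := congrArg star (hfp i)
    simp only [star_add, star_mul', star_zero] at this
    simp only [Complex.star_def, Complex.conj_ofReal] at this ⊢
    linear_combination this
  set U : Matrix (Fin 4) (Fin 4) ℂ := Matrix.of
    ![f 0, f 1, ![1, 0, 0, 0], ![0, p 1 / p 0, p 2 / p 0, p 3 / p 0]] with hU
  have hUU : U * Uᴴ = 1 := by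
    ext i j
    rw [Matrix.mul_apply]
    simp only [conjTranspose_apply, Fin.sum_univ_four, hU]
    have e00 := hfn 0 0
    have e01 := hfn 0 1
    have e10 := hfn 1 0
    have e11 := hfn 1 1
    have q0 := hfp 0
    have q1 := hfp 1
    have r0 := hfps 0
    have r1 := hfps 1
    simp at e00 e01 e10 e11 r0 r1
    fin_cases i <;> fin_cases j <;> simp [hf0] <;> field_simp
    · exact e00
    · exact e01
    · rw [mul_zero]; exact q0
    · exact e10
    · exact e11
    · rw [mul_zero]; exact q1
    · rw [mul_zero]; exact r0
    · rw [mul_zero]; exact r1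
    · linear_combination -hsC
  have hUU' : Uᴴ * U = 1 := mul_eq_one_comm.mp hUU
  have hsum : ∑ i, (∑ ρ, star (U i ρ) * a ρ) * star (∑ ρ, star (U i ρ) * b ρ)
      = ∑ ρ, a ρ * star (b ρ) := by
    have h1 : ∀ c : Fin 4 → ℂ, (fun i => ∑ ρ, star (U i ρ) * c ρ) = c ᵥ* Uᴴ := by
      intro c; ext i
      simp [vecMul, dotProduct, mul_comm]
    have h2 : ∀ i, ∑ ρ, star (U i ρ) * a ρ = (a ᵥ* Uᴴ) i := congrFun (h1 a)
    have h3 : ∀ i, ∑ ρ, star (U i ρ) * b ρ = (b ᵥ* Uᴴ) i := congrFun (h1 b)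
    simp only [h2, h3]
    change (a ᵥ* Uᴴ) ⬝ᵥ star (b ᵥ* Uᴴ) = a ⬝ᵥ star b
    rw [star_vecMul, conjTranspose_conjTranspose, dotProduct_mulVec, vecMul_vecMul, hUU',
      vecMul_one]
  have hshift : ∀ (c : Fin 4 → ℂ), ∑ ρ, (p ρ : ℂ) * c ρ = 0 → ∀ i,
      ∑ ρ, star (f i ρ) * c ρ = ∑ ρ, star (e i ρ) * c ρ := by
    intro c hc i
    simp only [hfs, sub_mul, Finset.sum_sub_distrib, mul_assoc, ← Finset.mul_sum, hc]
    simp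
  have hlast : ∀ (c : Fin 4 → ℂ), ∑ ρ, (p ρ : ℂ) * c ρ = 0 →
      ∑ ρ, star (U 3 ρ) * c ρ = -c 0 := by
    intro c hc
    simp only [Fin.sum_univ_four] at hc ⊢
    simp [hU]
    field_simp
    linear_combination hc
  have h2 : ∀ (c : Fin 4 → ℂ), ∑ ρ, star (U 2 ρ) * c ρ = c 0 := by
    intro c
    simp [hU, Fin.sum_univ_four]
  have h0 : ∀ ρ, U 0 ρ = f 0 ρ := fun ρ => rfl
  have h1 : ∀ ρ, U 1 ρ = f 1 ρ := fun ρ => rfl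
  rw [Fin.sum_univ_four (fun i => (∑ ρ, star (U i ρ) * a ρ) * star (∑ ρ, star (U i ρ) * b ρ)),
    hlast a ha, hlast b hb, h2, h2] at hsum
  simp only [h0, h1, hshift a ha, hshift b hb] at hsum
  rw [Fin.sum_univ_two, Fin.sum_univ_four (fun ρ => (metricSign ρ : ℂ) * (a ρ * star (b ρ)))]
  rw [Fin.sum_univ_four (fun ρ => a ρ * star (b ρ))] at hsum
  simp only [star_neg] at hsum
  simp only [metricSign]
  simp
  simp at hsum
  linear_combination hsum

/-! ### Colour sum -/

/-- The colour sum `∑_a Tr (T^a T^a) = 3 C_F`. -/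
theorem sum_colorGen : ∑ i : Fin 3, ∑ j : Fin 3, ∑ a : Fin 8,
    colorGen a j i * star (colorGen a j i) = 4 := by
  have h3 : ((Real.sqrt 3 : ℝ) : ℂ) * (Real.sqrt 3 : ℝ) = 3 := by
    rw [← Complex.ofReal_mul, Real.mul_self_sqrt (by norm_num)]; norm_num
  have h3' : ((Real.sqrt 3 : ℝ) : ℂ)⁻¹ * ((Real.sqrt 3 : ℝ) : ℂ)⁻¹ = 1 / 3 := by
    rw [← mul_inv, h3]; norm_num
  simp [Fin.sum_univ_succ, colorGen, gellMann]
  ring_nf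
  simp only [Complex.I_sq, Complex.conj_ofNat]
  linear_combination (norm := (simp; ring_nf)) (3 / 2 : ℂ) * h3'

/-! ### Reduction of the structure functions to traces -/

/-- The kinematical data of the two diagrams: the momenta and masses of the external quarks, the
momenta of the internal quarks in the diagrams with emission from the outgoing (`l₂`) and the
incoming (`l₁`) quark, and the inverse propagator denominators `x` and `y` of these diagrams. -/
structure Diagrams where
  k₁ : FourVec
  k₂ : FourVec
  l₂ : FourVec
  l₁ : FourVec
  m₁ : ℝ
  m₂ : ℝ
  x : ℝ
  y : ℝ

/-- The sum of the two diagrams, with a matrix `g` at the gluon vertex and `G` at the boson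
vertex. -/
def Diagrams.emission (d : Diagrams) (g G : Matrix (Fin 4) (Fin 4) ℂ) :
    Matrix (Fin 4) (Fin 4) ℂ :=
  (d.x : ℂ) • (g * (slash d.l₂ + (d.m₂ : ℂ) • 1) * G)
    + (d.y : ℂ) • (G * (slash d.l₁ + (d.m₁ : ℂ) • 1) * g)

/-- The Dirac adjoint of `emission`, in terms of the adjoint vertices. -/
def Diagrams.emissionBar (d : Diagrams) (g G : Matrix (Fin 4) (Fin 4) ℂ) :
    Matrix (Fin 4) (Fin 4) ℂ :=
  (d.x : ℂ) • (G * (slash d.l₂ + (d.m₂ : ℂ) • 1) * g)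
    + (d.y : ℂ) • (g * (slash d.l₁ + (d.m₁ : ℂ) • 1) * G)

/-- The trace to which the product of an amplitude and a conjugate amplitude is reduced by the
spin sums. -/
def Diagrams.chainTrace (d : Diagrams) (g G g' G' : Matrix (Fin 4) (Fin 4) ℂ) : ℂ :=
  trace ((slash d.k₂ + (d.m₂ : ℂ) • 1) * d.emission g G *
    ((slash d.k₁ + (d.m₁ : ℂ) • 1) * d.emissionBar g' G'))

/-- The diagrams of the process with momenta `K`. -/
def Momenta.diagrams (K : Momenta) (m₁ m₂ : ℝ) : Diagrams where
  k₁ := K.k₁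
  k₂ := K.k₂
  l₂ := K.k₂ + K.p
  l₁ := K.k₁ - K.p
  m₁ := m₁
  m₂ := m₂
  x := (mdot (K.k₂ + K.p) (K.k₂ + K.p) - m₂ ^ 2)⁻¹
  y := (mdot (K.k₁ - K.p) (K.k₁ - K.p) - m₁ ^ 2)⁻¹

theorem diracChain_eq (V A m₁ m₂ : ℝ) (K : Momenta) (e : Fin 4 → ℂ) (μ : Fin 4) :
    diracChain V A m₁ m₂ K e μ =
      (K.diagrams m₁ m₂).emission (slashC (star e)) (currentVertex V A μ) := rfl

theorem diracBar_emission (d : Diagrams) (g G : Matrix (Fin 4) (Fin 4) ℂ) :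
    diracBar (d.emission g G) = d.emissionBar (diracBar g) (diracBar G) := by
  simp only [Diagrams.emission, Diagrams.emissionBar, diracBar_add, diracBar_smul, diracBar_mul,
    diracBar_slash, diracBar_one, Complex.star_def, Complex.conj_ofReal, Matrix.mul_assoc]

theorem diracBar_currentVertex (V A : ℝ) (μ : Fin 4) :
    diracBar (currentVertex V A μ) = ((V : ℂ) • 1 + (A : ℂ) • gammaFive) * gammaLow μ := by
  simp only [currentVertex, diracBar_mul, diracBar_sub, diracBar_smul, diracBar_one,
    diracBar_gammaFive, diracBar_gammaLow, Complex.star_def, Complex.conj_ofReal, smul_neg,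
    sub_neg_eq_add]

theorem emission_slashC (d : Diagrams) (v : Fin 4 → ℂ) (G : Matrix (Fin 4) (Fin 4) ℂ) :
    d.emission (slashC v) G = ∑ ρ, v ρ • d.emission (gammaLow ρ) G := by
  simp only [Diagrams.emission, slashC, Matrix.sum_mul, Matrix.mul_sum, Finset.smul_sum,
    smul_add, Finset.sum_add_distrib, Matrix.smul_mul, Matrix.mul_smul]
  congr 1 <;> refine Finset.sum_congr rfl fun ρ _ => ?_ <;> rw [smul_comm]

/-- Gauge invariance: the sum of the two diagrams vanishes when the polarization vector of the
gluon is replaced by its momentum. -/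
theorem dotProduct_emission_slash {K : Momenta} {m₁ m₂ : ℝ} {u₁ u₂ : Fin 2 → Fin 4 → ℂ}
    (h₁ : IsSpinBasis K.k₁ m₁ u₁) (h₂ : IsSpinBasis K.k₂ m₂ u₂)
    (hx : mdot (K.k₂ + K.p) (K.k₂ + K.p) - m₂ ^ 2 ≠ 0)
    (hy : mdot (K.k₁ - K.p) (K.k₁ - K.p) - m₁ ^ 2 ≠ 0)
    (G : Matrix (Fin 4) (Fin 4) ℂ) (s r : Fin 2) :
    (star (u₂ r) ᵥ* gammaUp 0) ⬝ᵥ ((K.diagrams m₁ m₂).emission (slash K.p) G *ᵥ u₁ s) = 0 := by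
  set w := star (u₂ r) ᵥ* gammaUp 0 with hw
  have hwk : w ᵥ* slash K.k₂ = (m₂ : ℂ) • w := h₂.vecMul_slash r
  have hku : slash K.k₁ *ᵥ u₁ s = (m₁ : ℂ) • u₁ s := h₁.dirac s
  have e2 : slash K.p * (slash (K.k₂ + K.p) + (m₂ : ℂ) • 1) =
      ((mdot (K.k₂ + K.p) (K.k₂ + K.p) - m₂ ^ 2 : ℝ) : ℂ) • 1
        - (slash K.k₂ - (m₂ : ℂ) • 1) * (slash (K.k₂ + K.p) + (m₂ : ℂ) • 1) := by
    have h : slash K.p = slash (K.k₂ + K.p) - slash K.k₂ := by rw [slash_add]; abel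
    rw [h]
    simp only [Matrix.sub_mul, Matrix.mul_add, slash_mul_self, Matrix.smul_mul, Matrix.mul_smul,
      Matrix.one_mul, Matrix.mul_one]
    push_cast
    module
  have e1 : (slash (K.k₁ - K.p) + (m₁ : ℂ) • 1) * slash K.p =
      (slash (K.k₁ - K.p) + (m₁ : ℂ) • 1) * (slash K.k₁ - (m₁ : ℂ) • 1)
        - ((mdot (K.k₁ - K.p) (K.k₁ - K.p) - m₁ ^ 2 : ℝ) : ℂ) • 1 := by
    have h : slash K.p = slash K.k₁ - slash (K.k₁ - K.p) := by rw [slash_sub]; abel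
    rw [h]
    simp only [Matrix.mul_sub, Matrix.add_mul, slash_mul_self, Matrix.smul_mul, Matrix.mul_smul,
      Matrix.one_mul, Matrix.mul_one]
    push_cast
    module
  have hu0 : (slash K.k₁ - (m₁ : ℂ) • 1) *ᵥ u₁ s = 0 := by
    rw [sub_mulVec, hku, smul_mulVec, one_mulVec, sub_self]
  have hw0 : w ᵥ* (slash K.k₂ - (m₂ : ℂ) • 1) = 0 := by
    rw [vecMul_sub, hwk, vecMul_smul, vecMul_one, sub_self]
  have hxC : ((mdot (K.k₂ + K.p) (K.k₂ + K.p) - m₂ ^ 2 : ℝ) : ℂ) ≠ 0 := by exact_mod_cast hx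
  have hyC : ((mdot (K.k₁ - K.p) (K.k₁ - K.p) - m₁ ^ 2 : ℝ) : ℂ) ≠ 0 := by exact_mod_cast hy
  have t2 : w ⬝ᵥ ((slash K.p * (slash (K.k₂ + K.p) + (m₂ : ℂ) • 1) * G) *ᵥ u₁ s) =
      ((mdot (K.k₂ + K.p) (K.k₂ + K.p) - m₂ ^ 2 : ℝ) : ℂ) * (w ⬝ᵥ (G *ᵥ u₁ s)) := by
    rw [e2, Matrix.sub_mul, sub_mulVec, dotProduct_sub, Matrix.smul_mul, Matrix.one_mul,
      smul_mulVec, dotProduct_smul, smul_eq_mul, Matrix.mul_assoc (slash K.k₂ - _),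
      dotProduct_mulVec w (_ * _), ← vecMul_vecMul, hw0, zero_vecMul, zero_dotProduct, sub_zero]
  have t1 : w ⬝ᵥ ((G * (slash (K.k₁ - K.p) + (m₁ : ℂ) • 1) * slash K.p) *ᵥ u₁ s) =
      -((mdot (K.k₁ - K.p) (K.k₁ - K.p) - m₁ ^ 2 : ℝ) : ℂ) * (w ⬝ᵥ (G *ᵥ u₁ s)) := by
    rw [Matrix.mul_assoc, e1, Matrix.mul_sub, sub_mulVec, dotProduct_sub, Matrix.mul_smul,
      Matrix.mul_one, smul_mulVec, dotProduct_smul, smul_eq_mul, ← Matrix.mul_assoc,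
      ← mulVec_mulVec, hu0, mulVec_zero, dotProduct_zero]
    ring
  simp only [Diagrams.emission, Momenta.diagrams]
  rw [add_mulVec, smul_mulVec, smul_mulVec, dotProduct_add, dotProduct_smul, dotProduct_smul,
    t1, t2]
  simp only [smul_eq_mul, Complex.ofReal_inv]
  field_simp
  ring

/-- The structure function as a contracted trace: the sums over spins, polarizations and colours
have been carried out. -/
theorem structureFunction_eq (P : FourVec → FourVec → Fin 4 → Fin 4 → ℝ) {gs : ℝ} (hgs : gs ≠ 0)
    (c : Couplings) {m₁ m₂ : ℝ} {K : Momenta} {S : ExternalStates} (hK : K.IsPhysical m₁ m₂)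
    (hS : S.IsFor K m₁ m₂)
    (hx : mdot (K.k₂ + K.p) (K.k₂ + K.p) - m₂ ^ 2 ≠ 0)
    (hy : mdot (K.k₁ - K.p) (K.k₁ - K.p) - m₁ ^ 2 ≠ 0) :
    structureFunction P gs c m₁ m₂ K S =
      -∑ μ, ∑ ν, (P K.k₁ K.q μ ν : ℂ) * ∑ ρ, (metricSign ρ : ℂ) *
        (K.diagrams m₁ m₂).chainTrace (gammaLow ρ) (currentVertex c.V c.A μ) (gammaLow ρ)
          (((c.Vp : ℂ) • 1 + (c.Ap : ℂ) • gammaFive) * gammaLow ν) := by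
  set d := K.diagrams m₁ m₂ with hd
  -- the amplitude with the polarization vector stripped off
  set a : ℝ → ℝ → Fin 4 → Fin 2 → Fin 2 → Fin 4 → ℂ := fun V A μ s r ρ =>
    (star (S.u₂ r) ᵥ* gammaUp 0) ⬝ᵥ (d.emission (gammaLow ρ) (currentVertex V A μ) *ᵥ S.u₁ s)
    with ha
  have hamp : ∀ V A s r h i j b μ, amplitude gs V A m₁ m₂ K S s r h i j b μ =
      (gs : ℂ) * colorGen b j i * ∑ ρ, star (S.pol h ρ) * a V A μ s r ρ := by
    intro V A s r h i j b μ
    rw [amplitude, diracChain_eq, emission_slashC, sum_mulVec, dotProduct_sum]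
    simp only [smul_mulVec, dotProduct_smul, Pi.star_apply, smul_eq_mul, ha, hd]
  have hgauge : ∀ V A μ s r, ∑ ρ, (K.p ρ : ℂ) * a V A μ s r ρ = 0 := by
    intro V A μ s r
    have h := dotProduct_emission_slash hS.spin₁ hS.spin₂ hx hy
      (currentVertex V A μ) s r
    rw [slash, emission_slashC, sum_mulVec, dotProduct_sum] at h
    simpa only [smul_mulVec, dotProduct_smul, smul_eq_mul, ha, hd] using h
  have htr : ∀ V A V' A' μ ν ρ, ∑ s, ∑ r, a V A μ s r ρ * star (a V' A' ν s r ρ) =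
      d.chainTrace (gammaLow ρ) (currentVertex V A μ) (gammaLow ρ)
        (((V' : ℂ) • 1 + (A' : ℂ) • gammaFive) * gammaLow ν) := by
    intro V A V' A' μ ν ρ
    simp only [ha]
    rw [sum_spin_eq_trace hS.spin₁ hS.spin₂ hK.energy_k₁ hK.energy_k₂ hK.shell_k₁ hK.shell_k₂,
      diracBar_emission, diracBar_gammaLow, diracBar_currentVertex]
    rfl
  have hT : ∀ μ ν, averagedTensor gs c m₁ m₂ K S μ ν = -(2 / 3 * (gs : ℂ) ^ 2) *
      ∑ ρ, (metricSign ρ : ℂ) *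
        d.chainTrace (gammaLow ρ) (currentVertex c.V c.A μ) (gammaLow ρ)
          (((c.Vp : ℂ) • 1 + (c.Ap : ℂ) • gammaFive) * gammaLow ν) := by
    intro μ ν
    have h1 : ∀ i j b, ∑ s, ∑ r, ∑ h, amplitude gs c.V c.A m₁ m₂ K S s r h i j b μ *
        star (amplitude gs c.Vp c.Ap m₁ m₂ K S s r h i j b ν) =
        (colorGen b j i * star (colorGen b j i)) * (-(gs : ℂ) ^ 2 * ∑ ρ, (metricSign ρ : ℂ) *
        d.chainTrace (gammaLow ρ) (currentVertex c.V c.A μ) (gammaLow ρ)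
          (((c.Vp : ℂ) • 1 + (c.Ap : ℂ) • gammaFive) * gammaLow ν)) := by
      intro i j b
      have h2 : ∀ s r, ∑ h, amplitude gs c.V c.A m₁ m₂ K S s r h i j b μ *
          star (amplitude gs c.Vp c.Ap m₁ m₂ K S s r h i j b ν) =
          (colorGen b j i * star (colorGen b j i)) * (-(gs : ℂ) ^ 2) *
            ∑ ρ, (metricSign ρ : ℂ) *
              (a c.V c.A μ s r ρ * star (a c.Vp c.Ap ν s r ρ)) := by
        intro s r
        have h3 := hS.gluon.sum_eq hK.energy_p hK.shell_p (hgauge c.V c.A μ s r)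
          (hgauge c.Vp c.Ap ν s r)
        rw [mul_assoc, neg_mul, ← mul_neg, ← h3, Finset.mul_sum, Finset.mul_sum]
        refine Finset.sum_congr rfl fun h _ => ?_
        simp only [hamp, star_mul', Complex.star_def, Complex.conj_ofReal]
        ring
      simp only [h2, ← Finset.mul_sum]
      rw [mul_assoc]
      congr 2
      simp only [← htr, Finset.mul_sum]
      simp only [Fin.sum_univ_two, Finset.sum_add_distrib]
    rw [averagedTensor]
    simp only [h1, ← Finset.mul_sum, ← Finset.sum_mul, sum_colorGen]
    ring
  rw [structureFunction]
  simp only [hT]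
  have hg : (gs : ℂ) ≠ 0 := by exact_mod_cast hgs
  simp only [mul_left_comm _ (-(2 / 3 * (gs : ℂ) ^ 2)), ← Finset.mul_sum]
  rw [← mul_assoc, ← neg_one_mul]
  rw [casimirF]
  push_cast
  field_simp
  norm_num

/-! ### Elimination of `γ₅` -/

/-- The contraction `g^{μν} h(e_μ, e_ν)` of a form on four-vectors with the metric. -/
def metricTrace (h : FourVec → FourVec → ℂ) : ℂ :=
  ∑ μ, (metricSign μ : ℂ) * h (Pi.single μ 1) (Pi.single μ 1)

theorem eq_sum_single (a : FourVec) : a = ∑ μ, a μ • (Pi.single μ 1 : FourVec) := by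
  ext ν; simp [Finset.sum_apply, Pi.single_apply]

theorem mdot_single (μ : Fin 4) (a : FourVec) :
    mdot (Pi.single μ 1) a = metricSign μ * a μ := by
  simp [mdot, Pi.single_apply]

theorem metricSign_mul_self (μ : Fin 4) : metricSign μ * metricSign μ = 1 := by
  fin_cases μ <;> simp [metricSign]

/-- The reflection of four-vectors along `n`. -/
def reflect (n a : FourVec) : FourVec := a - (2 * mdot a n / mdot n n) • n

theorem reflect_of_mdot_eq_zero {n a : FourVec} (h : mdot a n = 0) : reflect n a = a := by
  simp [reflect, h]

/-- Reflections preserve the metric. -/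
theorem metricTrace_reflect (h : FourVec →ₗ[ℝ] FourVec →ₗ[ℝ] ℂ) {n : FourVec}
    (hn : mdot n n ≠ 0) :
    metricTrace (fun a b => h (reflect n a) (reflect n b)) = metricTrace (fun a b => h a b) := by
  have h1 : ∑ μ, ((metricSign μ * mdot (Pi.single μ 1) n : ℝ) : ℂ) * h (Pi.single μ 1) n =
      h n n := by
    have : h n n = h (∑ μ, n μ • (Pi.single μ 1 : FourVec)) n := by rw [← eq_sum_single]
    rw [this, map_sum, LinearMap.sum_apply]
    refine Finset.sum_congr rfl fun μ _ => ?_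
    rw [mdot_single, ← mul_assoc, metricSign_mul_self, one_mul, map_smul, LinearMap.smul_apply,
      Complex.real_smul]
  have h2 : ∑ μ, ((metricSign μ * mdot (Pi.single μ 1) n : ℝ) : ℂ) * h n (Pi.single μ 1) =
      h n n := by
    have : h n n = h n (∑ μ, n μ • (Pi.single μ 1 : FourVec)) := by rw [← eq_sum_single]
    rw [this, map_sum]
    refine Finset.sum_congr rfl fun μ _ => ?_
    rw [mdot_single, ← mul_assoc, metricSign_mul_self, one_mul, map_smul, Complex.real_smul]
  have h3 : ∑ μ, ((metricSign μ * mdot (Pi.single μ 1) n * mdot (Pi.single μ 1) n : ℝ) : ℂ) =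
      mdot n n := by
    rw [← Complex.ofReal_sum]
    congr 1
    rw [mdot]
    refine Finset.sum_congr rfl fun μ _ => ?_
    rw [mdot_single]
    linear_combination metricSign μ * n μ * n μ * metricSign_mul_self μ
  have hnC : (mdot n n : ℂ) ≠ 0 := by exact_mod_cast hn
  have key : metricTrace (fun a b => h (reflect n a) (reflect n b)) =
      metricTrace (fun a b => h a b)
        - (2 / mdot n n : ℂ) * ∑ μ, ((metricSign μ * mdot (Pi.single μ 1) n : ℝ) : ℂ) *
            h (Pi.single μ 1) n
        - (2 / mdot n n : ℂ) * ∑ μ, ((metricSign μ * mdot (Pi.single μ 1) n : ℝ) : ℂ) *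
            h n (Pi.single μ 1)
        + (4 / (mdot n n : ℂ) ^ 2 * h n n) *
          ∑ μ, ((metricSign μ * mdot (Pi.single μ 1) n * mdot (Pi.single μ 1) n : ℝ) : ℂ) := by
    simp only [metricTrace, Finset.mul_sum, ← Finset.sum_sub_distrib, ← Finset.sum_add_distrib]
    refine Finset.sum_congr rfl fun μ _ => ?_
    simp only [reflect, map_sub, LinearMap.sub_apply, map_smul, LinearMap.smul_apply,
      Complex.real_smul]
    push_cast
    field_simp
    ring
  rw [key, h1, h2, h3]
  field_simp
  ring

/-- The automorphism `M ↦ γ₅ n̸ M n̸ γ₅ / n²` of the Dirac algebra induced by the reflection along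
`n`. -/
def reflectDirac (n : FourVec) (M : Matrix (Fin 4) (Fin 4) ℂ) : Matrix (Fin 4) (Fin 4) ℂ :=
  ((mdot n n : ℂ)⁻¹) • (gammaFive * slash n * M * (slash n * gammaFive))

theorem reflectDirac_mul {n : FourVec} (hn : mdot n n ≠ 0) (M N : Matrix (Fin 4) (Fin 4) ℂ) :
    reflectDirac n (M * N) = reflectDirac n M * reflectDirac n N := by
  have hnC : (mdot n n : ℂ) ≠ 0 := by exact_mod_cast hn
  have h : slash n * gammaFive * (gammaFive * slash n) = (mdot n n : ℂ) • 1 := by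
    rw [Matrix.mul_assoc, ← Matrix.mul_assoc gammaFive, gammaFive_mul_self, Matrix.one_mul,
      slash_mul_self]
  have h2 : gammaFive * slash n * M * (slash n * gammaFive) *
      (gammaFive * slash n * N * (slash n * gammaFive)) =
      gammaFive * slash n * M * (slash n * gammaFive * (gammaFive * slash n)) * N *
        (slash n * gammaFive) := by simp only [Matrix.mul_assoc]
  rw [reflectDirac, reflectDirac, reflectDirac, Matrix.smul_mul, Matrix.mul_smul, h2, h,
    Matrix.mul_smul, Matrix.mul_one, Matrix.smul_mul, Matrix.smul_mul, smul_smul, smul_smul,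
    inv_mul_cancel_right₀ hnC]
  simp only [Matrix.mul_assoc]

theorem reflectDirac_add (n : FourVec) (M N : Matrix (Fin 4) (Fin 4) ℂ) :
    reflectDirac n (M + N) = reflectDirac n M + reflectDirac n N := by
  simp only [reflectDirac, Matrix.mul_add, Matrix.add_mul, smul_add]

theorem reflectDirac_smul (n : FourVec) (z : ℂ) (M : Matrix (Fin 4) (Fin 4) ℂ) :
    reflectDirac n (z • M) = z • reflectDirac n M := by
  simp only [reflectDirac, Matrix.mul_smul, Matrix.smul_mul, smul_comm z]

theorem reflectDirac_one {n : FourVec} (hn : mdot n n ≠ 0) : reflectDirac n 1 = 1 := by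
  have hnC : (mdot n n : ℂ) ≠ 0 := by exact_mod_cast hn
  rw [reflectDirac, Matrix.mul_one, Matrix.mul_assoc, ← Matrix.mul_assoc (slash n),
    slash_mul_self, Matrix.smul_mul, Matrix.one_mul, Matrix.mul_smul, gammaFive_mul_self,
    smul_smul, inv_mul_cancel₀ hnC, one_smul]

theorem trace_reflectDirac {n : FourVec} (hn : mdot n n ≠ 0) (M : Matrix (Fin 4) (Fin 4) ℂ) :
    trace (reflectDirac n M) = trace M := by
  have hnC : (mdot n n : ℂ) ≠ 0 := by exact_mod_cast hn
  rw [reflectDirac, trace_smul, trace_mul_comm, ← Matrix.mul_assoc, Matrix.mul_assoc (slash n),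
    ← Matrix.mul_assoc gammaFive, gammaFive_mul_self, Matrix.one_mul, slash_mul_self,
    Matrix.smul_mul, Matrix.one_mul, trace_smul, smul_smul, inv_mul_cancel₀ hnC, one_smul]

theorem reflectDirac_slash {n : FourVec} (hn : mdot n n ≠ 0) (a : FourVec) :
    reflectDirac n (slash a) = slash (reflect n a) := by
  have hnC : (mdot n n : ℂ) ≠ 0 := by exact_mod_cast hn
  have h : gammaFive * slash n * slash a * (slash n * gammaFive) =
      (mdot n n : ℂ) • slash (reflect n a) := by
    have h1 : slash n * slash a * slash n = ((2 * mdot n a : ℝ) : ℂ) • slash n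
        - (mdot n n : ℂ) • slash a := by
      rw [slash_mul_slash, Matrix.sub_mul, Matrix.mul_assoc, slash_mul_self, Matrix.smul_mul,
        Matrix.one_mul, Matrix.mul_smul, Matrix.mul_one]
    have h2 : gammaFive * slash n * slash a * (slash n * gammaFive) =
        gammaFive * (slash n * slash a * slash n) * gammaFive := by simp only [Matrix.mul_assoc]
    have h3 : ∀ b, gammaFive * slash b * gammaFive = -slash b := by
      intro b
      rw [gammaFive_mul_slash, Matrix.neg_mul, Matrix.mul_assoc, gammaFive_mul_self,
        Matrix.mul_one]
    rw [h2, h1, Matrix.mul_sub, Matrix.sub_mul, Matrix.mul_smul, Matrix.mul_smul,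
      Matrix.smul_mul, Matrix.smul_mul, h3, h3, reflect, slash_sub, slash_smul, smul_sub,
      smul_smul, mdot_comm n a]
    have : (mdot n n : ℂ) * ((2 * mdot a n / mdot n n : ℝ) : ℂ) = ((2 * mdot a n : ℝ) : ℂ) := by
      push_cast; field_simp
    rw [this]
    module
  rw [reflectDirac, h, smul_smul, inv_mul_cancel₀ hnC, one_smul]

theorem reflectDirac_gammaFive {n : FourVec} (hn : mdot n n ≠ 0) :
    reflectDirac n gammaFive = -gammaFive := by
  have hnC : (mdot n n : ℂ) ≠ 0 := by exact_mod_cast hn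
  rw [reflectDirac, gammaFive_mul_slash, Matrix.neg_mul, Matrix.neg_mul, Matrix.mul_assoc (slash n),
    gammaFive_mul_self, Matrix.mul_one, ← Matrix.mul_assoc, slash_mul_self, Matrix.smul_mul,
    Matrix.one_mul, smul_neg, smul_smul, inv_mul_cancel₀ hnC, one_smul]

/-- All momenta of the diagrams are orthogonal to `n`. -/
structure Diagrams.IsOrthogonal (d : Diagrams) (n : FourVec) : Prop where
  k₁ : mdot d.k₁ n = 0
  k₂ : mdot d.k₂ n = 0
  l₂ : mdot d.l₂ n = 0
  l₁ : mdot d.l₁ n = 0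

theorem chainTrace_reflectDirac {d : Diagrams} {n : FourVec} (hn : mdot n n ≠ 0)
    (hd : d.IsOrthogonal n) (g G g' G' : Matrix (Fin 4) (Fin 4) ℂ) :
    d.chainTrace (reflectDirac n g) (reflectDirac n G) (reflectDirac n g') (reflectDirac n G') =
      d.chainTrace g G g' G' := by
  rw [Diagrams.chainTrace, Diagrams.chainTrace]
  conv_rhs => rw [← trace_reflectDirac hn]
  simp only [Diagrams.emission, Diagrams.emissionBar, reflectDirac_mul hn, reflectDirac_add,
    reflectDirac_smul, reflectDirac_one hn, reflectDirac_slash hn,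
    reflect_of_mdot_eq_zero hd.k₁, reflect_of_mdot_eq_zero hd.k₂, reflect_of_mdot_eq_zero hd.l₂,
    reflect_of_mdot_eq_zero hd.l₁]

/-- The trace of the diagrams, summed over the gluon polarizations, as a form in the indices of
the currents `a̸ Γ` and `Γ' b̸`. -/
def Diagrams.tensor (d : Diagrams) (Γ Γ' : Matrix (Fin 4) (Fin 4) ℂ) (a b : FourVec) : ℂ :=
  ∑ ρ, (metricSign ρ : ℂ) *
    d.chainTrace (gammaLow ρ) (slash a * Γ) (gammaLow ρ) (Γ' * slash b)

theorem emission_add_right (d : Diagrams) (g G H : Matrix (Fin 4) (Fin 4) ℂ) :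
    d.emission g (G + H) = d.emission g G + d.emission g H := by
  simp only [Diagrams.emission, Matrix.mul_add, Matrix.add_mul, smul_add]; abel

theorem emission_smul_right (d : Diagrams) (z : ℂ) (g G : Matrix (Fin 4) (Fin 4) ℂ) :
    d.emission g (z • G) = z • d.emission g G := by
  simp only [Diagrams.emission, Matrix.mul_smul, Matrix.smul_mul, smul_add, smul_comm z]

theorem emission_add_left (d : Diagrams) (g h G : Matrix (Fin 4) (Fin 4) ℂ) :
    d.emission (g + h) G = d.emission g G + d.emission h G := by
  simp only [Diagrams.emission, Matrix.mul_add, Matrix.add_mul, smul_add]; abel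

theorem emission_smul_left (d : Diagrams) (z : ℂ) (g G : Matrix (Fin 4) (Fin 4) ℂ) :
    d.emission (z • g) G = z • d.emission g G := by
  simp only [Diagrams.emission, Matrix.mul_smul, Matrix.smul_mul, smul_add, smul_comm z]

theorem emissionBar_add_right (d : Diagrams) (g G H : Matrix (Fin 4) (Fin 4) ℂ) :
    d.emissionBar g (G + H) = d.emissionBar g G + d.emissionBar g H := by
  simp only [Diagrams.emissionBar, Matrix.mul_add, Matrix.add_mul, smul_add]; abel

theorem emissionBar_smul_right (d : Diagrams) (z : ℂ) (g G : Matrix (Fin 4) (Fin 4) ℂ) :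
    d.emissionBar g (z • G) = z • d.emissionBar g G := by
  simp only [Diagrams.emissionBar, Matrix.mul_smul, Matrix.smul_mul, smul_add, smul_comm z]

theorem emissionBar_add_left (d : Diagrams) (g h G : Matrix (Fin 4) (Fin 4) ℂ) :
    d.emissionBar (g + h) G = d.emissionBar g G + d.emissionBar h G := by
  simp only [Diagrams.emissionBar, Matrix.mul_add, Matrix.add_mul, smul_add]; abel

theorem emissionBar_smul_left (d : Diagrams) (z : ℂ) (g G : Matrix (Fin 4) (Fin 4) ℂ) :
    d.emissionBar (z • g) G = z • d.emissionBar g G := by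
  simp only [Diagrams.emissionBar, Matrix.mul_smul, Matrix.smul_mul, smul_add, smul_comm z]

theorem chainTrace_add₁ (d : Diagrams) (g h G g' G' : Matrix (Fin 4) (Fin 4) ℂ) :
    d.chainTrace (g + h) G g' G' = d.chainTrace g G g' G' + d.chainTrace h G g' G' := by
  rw [Diagrams.chainTrace, emission_add_left, Matrix.mul_add, Matrix.add_mul, trace_add]; rfl

theorem chainTrace_smul₁ (d : Diagrams) (z : ℂ) (g G g' G' : Matrix (Fin 4) (Fin 4) ℂ) :
    d.chainTrace (z • g) G g' G' = z * d.chainTrace g G g' G' := by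
  rw [Diagrams.chainTrace, emission_smul_left, Matrix.mul_smul, Matrix.smul_mul, trace_smul]; rfl

theorem chainTrace_add₂ (d : Diagrams) (g G H g' G' : Matrix (Fin 4) (Fin 4) ℂ) :
    d.chainTrace g (G + H) g' G' = d.chainTrace g G g' G' + d.chainTrace g H g' G' := by
  rw [Diagrams.chainTrace, emission_add_right, Matrix.mul_add, Matrix.add_mul, trace_add]; rfl

theorem chainTrace_smul₂ (d : Diagrams) (z : ℂ) (g G g' G' : Matrix (Fin 4) (Fin 4) ℂ) :
    d.chainTrace g (z • G) g' G' = z * d.chainTrace g G g' G' := by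
  rw [Diagrams.chainTrace, emission_smul_right, Matrix.mul_smul, Matrix.smul_mul, trace_smul]; rfl

theorem chainTrace_add₃ (d : Diagrams) (g G g' h' G' : Matrix (Fin 4) (Fin 4) ℂ) :
    d.chainTrace g G (g' + h') G' = d.chainTrace g G g' G' + d.chainTrace g G h' G' := by
  rw [Diagrams.chainTrace, emissionBar_add_left, Matrix.mul_add, Matrix.mul_add, trace_add]; rfl

theorem chainTrace_smul₃ (d : Diagrams) (z : ℂ) (g G g' G' : Matrix (Fin 4) (Fin 4) ℂ) :
    d.chainTrace g G (z • g') G' = z * d.chainTrace g G g' G' := by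
  rw [Diagrams.chainTrace, emissionBar_smul_left, Matrix.mul_smul, Matrix.mul_smul, trace_smul]
  rfl

theorem chainTrace_add₄ (d : Diagrams) (g G g' G' H' : Matrix (Fin 4) (Fin 4) ℂ) :
    d.chainTrace g G g' (G' + H') = d.chainTrace g G g' G' + d.chainTrace g G g' H' := by
  rw [Diagrams.chainTrace, emissionBar_add_right, Matrix.mul_add, Matrix.mul_add, trace_add]; rfl

theorem chainTrace_smul₄ (d : Diagrams) (z : ℂ) (g G g' G' : Matrix (Fin 4) (Fin 4) ℂ) :
    d.chainTrace g G g' (z • G') = z * d.chainTrace g G g' G' := by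
  rw [Diagrams.chainTrace, emissionBar_smul_right, Matrix.mul_smul, Matrix.mul_smul, trace_smul]
  rfl

/-- `tensor` as a bilinear map. -/
def Diagrams.tensorLin (d : Diagrams) (Γ Γ' : Matrix (Fin 4) (Fin 4) ℂ) :
    FourVec →ₗ[ℝ] FourVec →ₗ[ℝ] ℂ :=
  LinearMap.mk₂ ℝ (d.tensor Γ Γ')
    (fun a a' b => by
      simp only [Diagrams.tensor, slash_add, Matrix.add_mul, chainTrace_add₂, mul_add,
        Finset.sum_add_distrib])
    (fun z a b => by
      simp only [Diagrams.tensor, slash_smul, Matrix.smul_mul, chainTrace_smul₂,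
        Complex.real_smul, Finset.mul_sum, mul_left_comm])
    (fun a b b' => by
      simp only [Diagrams.tensor, slash_add, chainTrace_add₄, mul_add,
        Finset.sum_add_distrib])
    (fun z a b => by
      simp only [Diagrams.tensor, slash_smul, Matrix.mul_smul, chainTrace_smul₄,
        Complex.real_smul, Finset.mul_sum, mul_left_comm])

theorem tensorLin_apply (d : Diagrams) (Γ Γ' : Matrix (Fin 4) (Fin 4) ℂ) (a b : FourVec) :
    d.tensorLin Γ Γ' a b = d.tensor Γ Γ' a b := rfl

/-- `chainTrace` as a bilinear map of the vectors at the two gluon vertices. -/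
def Diagrams.gluonLin (d : Diagrams) (G G' : Matrix (Fin 4) (Fin 4) ℂ) :
    FourVec →ₗ[ℝ] FourVec →ₗ[ℝ] ℂ :=
  LinearMap.mk₂ ℝ (fun a b => d.chainTrace (slash a) G (slash b) G')
    (fun a a' b => by simp only [slash_add, chainTrace_add₁])
    (fun z a b => by simp only [slash_smul, chainTrace_smul₁, Complex.real_smul])
    (fun a b b' => by simp only [slash_add, chainTrace_add₃])
    (fun z a b => by simp only [slash_smul, chainTrace_smul₃, Complex.real_smul])

theorem gluonLin_apply (d : Diagrams) (G G' : Matrix (Fin 4) (Fin 4) ℂ) (a b : FourVec) :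
    d.gluonLin G G' a b = d.chainTrace (slash a) G (slash b) G' := rfl

theorem tensor_eq_metricTrace (d : Diagrams) (Γ Γ' : Matrix (Fin 4) (Fin 4) ℂ) (a b : FourVec) :
    d.tensor Γ Γ' a b =
      metricTrace (fun u v => d.gluonLin (slash a * Γ) (Γ' * slash b) u v) := by
  simp only [Diagrams.tensor, metricTrace, gluonLin_apply, gammaLow_eq_slash]

/-- Covariance of `tensor` under a reflection that leaves the momenta of the diagrams fixed. -/
theorem tensor_reflect {d : Diagrams} {n : FourVec} (hn : mdot n n ≠ 0) (hd : d.IsOrthogonal n)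
    (Γ Γ' : Matrix (Fin 4) (Fin 4) ℂ) (a b : FourVec) :
    d.tensor (reflectDirac n Γ) (reflectDirac n Γ') (reflect n a) (reflect n b) =
      d.tensor Γ Γ' a b := by
  rw [tensor_eq_metricTrace, tensor_eq_metricTrace, ← metricTrace_reflect _ hn]
  simp only [gluonLin_apply, ← reflectDirac_slash hn,
    ← reflectDirac_mul hn, chainTrace_reflectDirac hn hd]

/-- The contraction of a form with `α g^{μν} + β k^μ k^ν + γ q^μ q^ν + δ (k^μ q^ν + q^μ k^ν)`. -/
def project (α β γ δ : ℝ) (k q : FourVec) (h : FourVec → FourVec → ℂ) : ℂ :=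
  α * metricTrace h + β * h k k + γ * h q q + δ * (h k q + h q k)

theorem sum_mul_eq_project (α β γ δ : ℝ) (k q : FourVec) (h : FourVec →ₗ[ℝ] FourVec →ₗ[ℝ] ℂ) :
    ∑ μ, ∑ ν, ((α * metricUp μ ν + β * (k μ * k ν) + γ * (q μ * q ν)
      + δ * (k μ * q ν + q μ * k ν) : ℝ) : ℂ) * h (Pi.single μ 1) (Pi.single ν 1) =
      project α β γ δ k q (fun a b => h a b) := by
  have h1 : ∀ a b : FourVec, h a b =
      ∑ μ, ∑ ν, ((a μ * b ν : ℝ) : ℂ) * h (Pi.single μ 1) (Pi.single ν 1) := by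
    intro a b
    conv_lhs => rw [eq_sum_single a, eq_sum_single b]
    simp only [map_sum, LinearMap.sum_apply, map_smul, LinearMap.smul_apply, Complex.real_smul,
      Finset.mul_sum]
    rw [Finset.sum_comm]
    refine Finset.sum_congr rfl fun μ _ => Finset.sum_congr rfl fun ν _ => ?_
    push_cast; ring
  have h2 : metricTrace (fun a b => h a b) =
      ∑ μ, ∑ ν, (metricUp μ ν : ℂ) * h (Pi.single μ 1) (Pi.single ν 1) := by
    rw [metricTrace]
    refine Finset.sum_congr rfl fun μ _ => ?_
    rw [Finset.sum_eq_single μ]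
    · simp [metricUp]
    · intro ν _ hν; simp [metricUp, Ne.symm hν]
    · simp
  rw [project, h2, h1 k k, h1 q q, h1 k q, h1 q k]
  simp only [Finset.mul_sum, ← Finset.sum_add_distrib]
  refine Finset.sum_congr rfl fun μ _ => Finset.sum_congr rfl fun ν _ => ?_
  push_cast; ring

/-- Parity-odd contributions drop out: a vector `n` orthogonal to all momenta gives a reflection
that fixes the momenta and changes the sign of `γ₅`. -/
theorem project_tensor_eq_zero {d : Diagrams} {n : FourVec} (hn : mdot n n ≠ 0)
    (hd : d.IsOrthogonal n) {Γ Γ' : Matrix (Fin 4) (Fin 4) ℂ}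
    (hΓ : ∀ a b, d.tensor (reflectDirac n Γ) (reflectDirac n Γ') a b = -d.tensor Γ Γ' a b)
    {k q : FourVec} (hk : mdot k n = 0) (hq : mdot q n = 0) (α β γ δ : ℝ) :
    project α β γ δ k q (d.tensor Γ Γ') = 0 := by
  have h : ∀ a b, d.tensor Γ Γ' (reflect n a) (reflect n b) = -d.tensor Γ Γ' a b := by
    intro a b
    rw [← tensor_reflect hn hd Γ Γ' a b, hΓ, neg_neg]
  have h0 : ∀ a b, mdot a n = 0 → mdot b n = 0 → d.tensor Γ Γ' a b = 0 := by
    intro a b ha hb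
    have := h a b
    rw [reflect_of_mdot_eq_zero ha, reflect_of_mdot_eq_zero hb] at this
    linear_combination this / 2
  have hm : metricTrace (d.tensor Γ Γ') = 0 := by
    have h1 := metricTrace_reflect (d.tensorLin Γ Γ') hn
    simp only [tensorLin_apply, h] at h1
    have h2 : metricTrace (fun a b => -d.tensor Γ Γ' a b) = -metricTrace (d.tensor Γ Γ') := by
      simp [metricTrace]
    rw [h2] at h1
    change -metricTrace (d.tensor Γ Γ') = metricTrace (d.tensor Γ Γ') at h1
    linear_combination -h1 / 2
  rw [project, hm, h0 k k hk hk, h0 q q hq hq, h0 k q hk hq, h0 q k hq hk]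
  simp

/-- The diagrams with the opposite sign of the mass of the incoming quark. -/
def Diagrams.flip (d : Diagrams) : Diagrams := { d with m₁ := -d.m₁ }

/-- Moving both `γ₅` of the axial currents through the incoming quark line reverses the sign of
its mass. -/
theorem tensor_gammaFive (d : Diagrams) (a b : FourVec) :
    d.tensor gammaFive gammaFive a b = -d.flip.tensor 1 1 a b := by
  rw [Diagrams.tensor, Diagrams.tensor, ← Finset.sum_neg_distrib]
  refine Finset.sum_congr rfl fun ρ _ => ?_
  rw [← mul_neg]
  congr 1
  have hL : d.emission (gammaLow ρ) (slash a * gammaFive) =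
      d.flip.emission (gammaLow ρ) (slash a) * gammaFive := by
    have h : gammaFive * ((slash d.l₁ + (d.m₁ : ℂ) • 1) * gammaLow ρ) =
        (slash d.l₁ + ((-d.m₁ : ℝ) : ℂ) • 1) * (gammaLow ρ * gammaFive) := by
      rw [gammaLow_eq_slash]
      simp only [Matrix.add_mul, Matrix.mul_add, gammaFive_mul_slash_mul,
        gammaFive_mul_slash, Matrix.smul_mul, Matrix.mul_smul, Matrix.one_mul, Matrix.mul_neg]
      push_cast
      module
    simp only [Diagrams.emission, Diagrams.flip, Matrix.add_mul (_ • _), Matrix.smul_mul,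
      Matrix.mul_assoc, h]
  have hR : d.emissionBar (gammaLow ρ) (gammaFive * slash b) =
      gammaFive * d.flip.emissionBar (gammaLow ρ) (slash b) := by
    have h : gammaLow ρ * ((slash d.l₁ + (d.m₁ : ℂ) • 1) * (gammaFive * slash b)) =
        gammaFive * (gammaLow ρ * ((slash d.l₁ + ((-d.m₁ : ℝ) : ℂ) • 1) * slash b)) := by
      rw [gammaLow_eq_slash]
      simp only [Matrix.add_mul, Matrix.mul_add, gammaFive_mul_slash_mul,
        Matrix.smul_mul, Matrix.mul_smul, Matrix.one_mul, Matrix.mul_neg]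
      push_cast
      module
    simp only [Diagrams.emissionBar, Diagrams.flip, Matrix.mul_add gammaFive, Matrix.mul_smul,
      Matrix.mul_assoc, h]
  have hm : gammaFive * ((slash d.k₁ + (d.m₁ : ℂ) • 1) * gammaFive) =
      -(slash d.k₁ + ((-d.m₁ : ℝ) : ℂ) • 1) := by
    simp only [Matrix.add_mul, Matrix.mul_add, gammaFive_mul_slash_mul, Matrix.smul_mul,
      Matrix.one_mul, Matrix.mul_smul, gammaFive_mul_self, Matrix.mul_one]
    push_cast
    module
  rw [Diagrams.chainTrace, Diagrams.chainTrace, hL, hR, ← trace_neg]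
  congr 1
  calc _ = (slash d.k₂ + (d.m₂ : ℂ) • 1) * d.flip.emission (gammaLow ρ) (slash a) *
        (gammaFive * ((slash d.k₁ + (d.m₁ : ℂ) • 1) * gammaFive) *
          d.flip.emissionBar (gammaLow ρ) (slash b)) := by simp only [Matrix.mul_assoc]
    _ = _ := by
      rw [hm, Matrix.neg_mul, Matrix.mul_neg, Matrix.mul_one, Matrix.one_mul]
      rfl

/-! ### The contracted traces -/

/-- A quarter of the trace of a product of four slashed vectors. -/
def dot₄ (a b c d : FourVec) : ℝ :=
  mdot a b * mdot c d - mdot a c * mdot b d + mdot a d * mdot b c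

/-- A quarter of the trace of a product of six slashed vectors. -/
def dot₆ (a b c d e f : FourVec) : ℝ :=
  mdot a b * dot₄ c d e f - mdot a c * dot₄ b d e f + mdot a d * dot₄ b c e f
    - mdot a e * dot₄ b c d f + mdot a f * dot₄ b c d e

theorem trace_eq_dot₄ (a b c d : FourVec) :
    trace (slash a * (slash b * (slash c * slash d))) = 4 * (dot₄ a b c d : ℂ) := by
  rw [trace_slash₄, dot₄]; push_cast; ring

theorem trace_eq_dot₆ (a b c d e f : FourVec) :
    trace (slash a * (slash b * (slash c * (slash d * (slash e * slash f))))) =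
      4 * (dot₆ a b c d e f : ℂ) := by
  rw [trace_slash₆, dot₆]; simp only [dot₄]; push_cast; ring

theorem contract_slash_add (k : FourVec) (m : ℂ) :
    contract (slash k + m • 1) = (-2 : ℂ) • slash k + (4 * m) • 1 := by
  rw [contract_add, contract_smul, contract_slash, contract_one, smul_smul, mul_comm]

theorem contract_line (v a w : FourVec) (m m' : ℂ) :
    contract ((slash v + m • 1) * slash a * (slash w + m' • 1)) =
      (-2 : ℂ) • (slash w * (slash a * slash v))
        + (4 * m * (mdot a w : ℂ) + 4 * m' * (mdot v a : ℂ)) • 1 - (2 * m * m') • slash a := by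
  have h : (slash v + m • 1) * slash a * (slash w + m' • 1) =
      slash v * (slash a * slash w) + m • (slash a * slash w) + m' • (slash v * slash a)
        + (m * m') • slash a := by
    simp only [Matrix.add_mul, Matrix.mul_add, Matrix.smul_mul, Matrix.mul_smul, Matrix.one_mul,
      Matrix.mul_one, Matrix.mul_assoc]
    module
  rw [h, contract_add, contract_add, contract_add, contract_smul, contract_smul, contract_smul,
    contract_slash₃, contract_slash₂, contract_slash₂, contract_slash]
  push_cast
  module

/-- Summation over the gluon polarizations in the product of two diagrams. -/
theorem sum_gluon (L M N R A B : Matrix (Fin 4) (Fin 4) ℂ) (x y : ℂ) :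
    ∑ ρ, (metricSign ρ : ℂ) * trace (L * (x • (gammaLow ρ * M * A) + y • (A * N * gammaLow ρ)) *
        (R * (x • (B * M * gammaLow ρ) + y • (gammaLow ρ * N * B)))) =
      x * x * trace (contract L * M * A * R * B * M)
        + x * y * (trace (L * contract (M * A * R) * N * B)
          + trace (L * A * N * contract (R * B * M)))
        + y * y * trace (L * A * N * contract R * N * B) := by
  simp only [contract, Matrix.sum_mul, trace_sum, Finset.mul_sum,
    ← Finset.sum_add_distrib]
  refine Finset.sum_congr rfl fun ρ _ => ?_
  have h : trace (gammaLow ρ * L * gammaLow ρ * M * A * R * B * M) =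
      trace (L * (gammaLow ρ * M * A) * (R * (B * M * gammaLow ρ))) := by
    simp only [Matrix.mul_assoc]
    rw [trace_mul_comm (gammaLow ρ)]
    simp only [Matrix.mul_assoc]
  simp only [Matrix.mul_smul, Matrix.smul_mul, trace_smul, smul_eq_mul, h]
  simp only [Matrix.mul_add, Matrix.add_mul, Matrix.mul_smul, Matrix.smul_mul, trace_add,
    trace_smul, smul_eq_mul, Matrix.mul_assoc]
  ring

/-- A quarter of the product of the diagrams for vector currents with indices `a` and `b`. -/
def Diagrams.hadron (d : Diagrams) (a b : FourVec) : ℝ :=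
  d.x * d.x * (-2 * dot₆ d.k₂ d.l₂ a d.k₁ b d.l₂ - 2 * d.m₁ * d.m₂ * dot₄ d.k₂ d.l₂ a b
      - 2 * d.m₂ ^ 2 * dot₄ d.k₂ a d.k₁ b - 2 * d.m₁ * d.m₂ * dot₄ d.k₂ a b d.l₂
      + 4 * d.m₂ ^ 2 * dot₄ d.l₂ a d.k₁ b + 4 * d.m₁ * d.m₂ * dot₄ d.l₂ a b d.l₂
      + 4 * d.m₂ ^ 2 * dot₄ a d.k₁ b d.l₂ + 4 * d.m₁ * d.m₂ ^ 3 * mdot a b)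
    + d.x * d.y * (-2 * dot₆ d.k₂ d.k₁ a d.l₂ d.l₁ b - 2 * d.m₁ * d.m₂ * dot₄ d.k₁ a d.l₂ b
      + (4 * d.m₂ * mdot a d.k₁ + 4 * d.m₁ * mdot d.l₂ a)
        * (d.m₁ * mdot d.k₂ b + d.m₂ * mdot d.l₁ b)
      - 2 * d.m₁ * d.m₂ * (dot₄ d.k₂ a d.l₁ b + d.m₁ * d.m₂ * mdot a b)
      - 2 * dot₆ d.k₂ a d.l₁ d.l₂ b d.k₁ - 2 * d.m₁ * d.m₂ * dot₄ a d.l₂ b d.k₁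
      + (4 * d.m₁ * mdot b d.l₂ + 4 * d.m₂ * mdot d.k₁ b)
        * (d.m₁ * mdot d.k₂ a + d.m₂ * mdot a d.l₁)
      - 2 * d.m₁ * d.m₂ * (dot₄ d.k₂ a d.l₁ b + d.m₁ * d.m₂ * mdot a b))
    + d.y * d.y * (-2 * dot₆ d.k₂ a d.l₁ d.k₁ d.l₁ b + 8 * d.m₁ ^ 2 * dot₄ d.k₂ a d.l₁ b
      - 2 * d.m₁ ^ 2 * dot₄ d.k₂ a d.k₁ b - 2 * d.m₁ * d.m₂ * dot₄ a d.l₁ d.k₁ b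
      - 2 * d.m₁ * d.m₂ * dot₄ a d.k₁ d.l₁ b + 4 * d.m₁ * d.m₂ * dot₄ a d.l₁ d.l₁ b
      + 4 * d.m₁ ^ 3 * d.m₂ * mdot a b)

theorem tensor_one_one (d : Diagrams) (a b : FourVec) :
    d.tensor 1 1 a b = ((4 * d.hadron a b : ℝ) : ℂ) := by
  simp only [Diagrams.tensor, Diagrams.chainTrace, Diagrams.emission, Diagrams.emissionBar,
    Matrix.mul_one, Matrix.one_mul]
  rw [sum_gluon, contract_slash_add, contract_slash_add, contract_line, contract_line]
  simp only [Matrix.mul_add, Matrix.add_mul, Matrix.mul_sub, Matrix.sub_mul, Matrix.mul_smul,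
    Matrix.smul_mul, Matrix.mul_one, Matrix.one_mul, Matrix.mul_assoc, smul_add, smul_sub,
    trace_add, trace_sub, trace_smul, smul_eq_mul, trace_eq_dot₆, trace_eq_dot₄, trace_slash₂,
    trace_slash₃, trace_slash₅, trace_slash, mul_zero, add_zero, zero_add]
  rw [Diagrams.hadron]
  push_cast
  ring

theorem sum_trace_contract (A X B : Matrix (Fin 4) (Fin 4) ℂ) :
    ∑ μ, (metricSign μ : ℂ) * trace (A * gammaLow μ * X * gammaLow μ * B) =
      trace (A * contract X * B) := by
  simp only [contract, Matrix.mul_sum, Matrix.sum_mul, trace_sum, Matrix.mul_smul,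
    Matrix.smul_mul, trace_smul, smul_eq_mul, Matrix.mul_assoc]

theorem trace_mul_contract (A B : Matrix (Fin 4) (Fin 4) ℂ) :
    trace (A * contract B) = trace (contract A * B) := by
  simp only [contract, Matrix.sum_mul, Matrix.mul_sum, trace_sum, Matrix.mul_smul,
    Matrix.smul_mul, trace_smul]
  refine Finset.sum_congr rfl fun μ _ => ?_
  rw [← Matrix.mul_assoc, trace_mul_comm]
  simp only [Matrix.mul_assoc]

theorem sum_mdot_mul_trace (A B : Matrix (Fin 4) (Fin 4) ℂ) (v : FourVec) :
    ∑ μ, (metricSign μ : ℂ) * ((mdot (Pi.single μ 1) v : ℂ) * trace (A * gammaLow μ * B)) =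
      trace (A * slash v * B) := by
  rw [slash_eq_sum_mdot v]
  simp only [Matrix.mul_sum, Matrix.sum_mul, trace_sum, Matrix.mul_smul,
    Matrix.smul_mul, trace_smul, smul_eq_mul]
  refine Finset.sum_congr rfl fun μ _ => ?_
  push_cast; ring

/-- A quarter of the product of the diagrams for vector currents, contracted with the metric. -/
def Diagrams.hadronTrace (d : Diagrams) : ℝ :=
  d.x * d.x * (4 * dot₄ d.k₂ d.l₂ d.k₁ d.l₂ - 16 * d.m₁ * d.m₂ * mdot d.k₂ d.l₂
      + 4 * d.m₂ ^ 2 * mdot d.k₂ d.k₁ - 16 * d.m₂ ^ 2 * mdot d.l₂ d.k₁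
      + 16 * d.m₁ * d.m₂ * mdot d.l₂ d.l₂ + 16 * d.m₁ * d.m₂ ^ 3)
    + 2 * d.x * d.y * (-8 * mdot d.l₂ d.l₁ * mdot d.k₂ d.k₁ + 4 * d.m₁ * d.m₂ * mdot d.k₁ d.l₂
      + 4 * d.m₂ * (d.m₁ * mdot d.k₂ d.k₁ + d.m₂ * mdot d.l₁ d.k₁)
      + 4 * d.m₁ * (d.m₁ * mdot d.k₂ d.l₂ + d.m₂ * mdot d.l₁ d.l₂)
      + 4 * d.m₁ * d.m₂ * mdot d.k₂ d.l₁ - 8 * d.m₁ ^ 2 * d.m₂ ^ 2)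
    + d.y * d.y * (4 * dot₄ d.k₂ d.l₁ d.k₁ d.l₁ - 16 * d.m₁ ^ 2 * mdot d.k₂ d.l₁
      + 4 * d.m₁ ^ 2 * mdot d.k₂ d.k₁ - 16 * d.m₁ * d.m₂ * mdot d.l₁ d.k₁
      + 16 * d.m₁ * d.m₂ * mdot d.l₁ d.l₁ + 16 * d.m₁ ^ 3 * d.m₂)

theorem contract_slash_mul_slash_add (v w : FourVec) (m : ℂ) :
    contract (slash v * (slash w + m • 1)) =
      (4 * (mdot v w : ℂ)) • 1 - (2 * m) • slash v := by
  rw [Matrix.mul_add, Matrix.mul_smul, Matrix.mul_one, contract_add, contract_smul,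
    contract_slash₂, contract_slash]
  push_cast
  module

theorem contract_slash_add_mul_slash (v w : FourVec) (m : ℂ) :
    contract ((slash w + m • 1) * slash v) =
      (4 * (mdot v w : ℂ)) • 1 - (2 * m) • slash v := by
  rw [Matrix.add_mul, Matrix.smul_mul, Matrix.one_mul, contract_add, contract_smul,
    contract_slash₂, contract_slash, mdot_comm]
  push_cast
  module

/-- The interference of the two diagrams, contracted with the metric. -/
theorem sum_interference (L N : Matrix (Fin 4) (Fin 4) ℂ) (v w : FourVec) (m m' : ℂ) :
    ∑ μ, (metricSign μ : ℂ) *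
        trace (L * contract ((slash v + m • 1) * gammaLow μ * (slash w + m' • 1)) * N
          * gammaLow μ) =
      -2 * trace (L * slash w * contract (slash v * N))
        + 4 * m * trace (L * N * slash w) + 4 * m' * trace (L * N * slash v)
        - 2 * m * m' * trace (L * contract N) := by
  have h1 := sum_trace_contract (L * slash w) (slash v * N) 1
  have h2 := sum_mdot_mul_trace (L * N) 1 w
  have h3 := sum_mdot_mul_trace (L * N) 1 v
  have h4 := sum_trace_contract L N 1
  simp only [Matrix.mul_one] at h1 h2 h3 h4
  rw [← h1, ← h2, ← h3, ← h4]
  simp only [Finset.mul_sum, ← Finset.sum_add_distrib, ← Finset.sum_sub_distrib]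
  refine Finset.sum_congr rfl fun μ _ => ?_
  rw [gammaLow_eq_slash, contract_line, mdot_comm v]
  simp only [Matrix.mul_add, Matrix.add_mul, Matrix.mul_sub, Matrix.sub_mul, Matrix.mul_smul,
    Matrix.smul_mul, Matrix.mul_one, Matrix.mul_assoc,
    trace_add, trace_sub, trace_smul, smul_eq_mul]
  ring

theorem sum_interference' (L N : Matrix (Fin 4) (Fin 4) ℂ) (v w : FourVec) (m m' : ℂ) :
    ∑ μ, (metricSign μ : ℂ) *
        trace (L * gammaLow μ * N *
          contract ((slash w + m' • 1) * gammaLow μ * (slash v + m • 1))) =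
      -2 * trace (L * contract (N * slash v) * slash w)
        + 4 * m * trace (L * slash w * N) + 4 * m' * trace (L * slash v * N)
        - 2 * m * m' * trace (L * contract N) := by
  have h1 := sum_trace_contract L (N * slash v) (slash w)
  have h2 := sum_mdot_mul_trace L N w
  have h3 := sum_mdot_mul_trace L N v
  have h4 := sum_trace_contract L N 1
  simp only [Matrix.mul_one] at h4
  rw [← h1, ← h2, ← h3, ← h4]
  simp only [Finset.mul_sum, ← Finset.sum_add_distrib, ← Finset.sum_sub_distrib]
  refine Finset.sum_congr rfl fun μ _ => ?_
  rw [gammaLow_eq_slash, contract_line, mdot_comm w]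
  simp only [Matrix.mul_add, Matrix.mul_sub, Matrix.mul_smul,
    Matrix.mul_one, Matrix.mul_assoc,
    trace_add, trace_sub, trace_smul, smul_eq_mul]
  ring

theorem metricTrace_tensor (d : Diagrams) :
    metricTrace (d.tensor 1 1) = ((4 * d.hadronTrace : ℝ) : ℂ) := by
  set L := slash d.k₂ + (d.m₂ : ℂ) • 1 with hL
  set R := slash d.k₁ + (d.m₁ : ℂ) • 1 with hR
  set M := slash d.l₂ + (d.m₂ : ℂ) • 1 with hM
  set N := slash d.l₁ + (d.m₁ : ℂ) • 1 with hN
  have hx := sum_trace_contract (contract L * M) R M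
  have hy := sum_trace_contract L (N * contract R * N) 1
  have hxy := sum_interference L N d.l₂ d.k₁ d.m₂ d.m₁
  have hyx := sum_interference' L N d.l₂ d.k₁ d.m₂ d.m₁
  have h : metricTrace (d.tensor 1 1) =
      d.x * d.x * trace (contract L * M * contract R * M)
        + d.x * d.y * ((-2 * trace (L * slash d.k₁ * contract (slash d.l₂ * N))
          + 4 * d.m₂ * trace (L * N * slash d.k₁) + 4 * d.m₁ * trace (L * N * slash d.l₂)
          - 2 * d.m₂ * d.m₁ * trace (L * contract N))
          + (-2 * trace (L * contract (N * slash d.l₂) * slash d.k₁)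
          + 4 * d.m₂ * trace (L * slash d.k₁ * N) + 4 * d.m₁ * trace (L * slash d.l₂ * N)
          - 2 * d.m₂ * d.m₁ * trace (L * contract N)))
        + d.y * d.y * trace (L * contract (N * contract R * N)) := by
    rw [← hxy, ← hyx, ← hx, ← Matrix.mul_one (L * contract _), ← hy]
    simp only [metricTrace, Diagrams.tensor, Diagrams.chainTrace, Diagrams.emission,
      Diagrams.emissionBar, Matrix.mul_one, Matrix.one_mul, ← hL, ← hR, ← hM, ← hN, sum_gluon]
    simp only [Finset.mul_sum, ← Finset.sum_add_distrib, gammaLow_eq_slash]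
    refine Finset.sum_congr rfl fun μ _ => ?_
    simp only [Matrix.mul_assoc]
    ring
  rw [h, trace_mul_contract L (N * _ * N), hL, hR, hM, hN, contract_slash_add,
    contract_slash_add, contract_slash_add,
    contract_slash_mul_slash_add, contract_slash_add_mul_slash]
  simp only [Matrix.mul_add, Matrix.add_mul, Matrix.mul_sub, Matrix.sub_mul, Matrix.mul_smul,
    Matrix.smul_mul, Matrix.mul_one, Matrix.one_mul, Matrix.mul_assoc, smul_add,
    trace_add, trace_sub, trace_smul, smul_eq_mul, trace_eq_dot₄, trace_slash₂,
    trace_slash₃, trace_slash, mul_zero, add_zero, zero_add, trace_one]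
  rw [Diagrams.hadronTrace, mdot_comm d.k₁ d.l₂, mdot_comm d.l₁ d.l₂, mdot_comm d.k₁ d.l₁]
  push_cast
  norm_num
  ring

/-! ### Kinematics and evaluation of the projections -/

/-- The Minkowski products of the momenta of the diagrams and of the boson, in terms of the
invariants `Q²`, `ŝ₁` and `t̂₁`. -/
structure Diagrams.HasInvariants (d : Diagrams) (q : FourVec) (Q2 s t : ℝ) : Prop where
  k₁k₁ : mdot d.k₁ d.k₁ = d.m₁ ^ 2
  k₂k₂ : mdot d.k₂ d.k₂ = d.m₂ ^ 2
  l₂l₂ : mdot d.l₂ d.l₂ = s + d.m₂ ^ 2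
  l₁l₁ : mdot d.l₁ d.l₁ = t + d.m₁ ^ 2
  qq : mdot q q = -Q2
  k₁k₂ : mdot d.k₁ d.k₂ = (Q2 + d.m₁ ^ 2 + d.m₂ ^ 2 + s + t) / 2
  k₁l₂ : mdot d.k₁ d.l₂ = (Q2 + d.m₁ ^ 2 + d.m₂ ^ 2 + s) / 2
  k₁l₁ : mdot d.k₁ d.l₁ = d.m₁ ^ 2 + t / 2
  k₁q : mdot d.k₁ q = (Q2 - d.m₁ ^ 2 + d.m₂ ^ 2 + s) / 2
  k₂l₂ : mdot d.k₂ d.l₂ = d.m₂ ^ 2 + s / 2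
  k₂l₁ : mdot d.k₂ d.l₁ = (Q2 + d.m₁ ^ 2 + d.m₂ ^ 2 + t) / 2
  k₂q : mdot d.k₂ q = (-Q2 - d.m₁ ^ 2 + d.m₂ ^ 2 - t) / 2
  l₂l₁ : mdot d.l₂ d.l₁ = (Q2 + d.m₁ ^ 2 + d.m₂ ^ 2) / 2
  l₂q : mdot d.l₂ q = (-Q2 - d.m₁ ^ 2 + d.m₂ ^ 2 + s) / 2
  l₁q : mdot d.l₁ q = (Q2 - d.m₁ ^ 2 + d.m₂ ^ 2 - t) / 2
  x_eq : d.x = s⁻¹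
  y_eq : d.y = t⁻¹

theorem Diagrams.HasInvariants.flip {d : Diagrams} {q : FourVec} {Q2 s t : ℝ}
    (h : d.HasInvariants q Q2 s t) : d.flip.HasInvariants q Q2 s t := by
  obtain ⟨h1, h2, h3, h4, h5, h6, h7, h8, h9, h10, h11, h12, h13, h14, h15, h16, h17⟩ := h
  constructor <;> simpa only [Diagrams.flip, neg_sq]

theorem Momenta.IsPhysical.hasInvariants {K : Momenta} {m₁ m₂ : ℝ} (h : K.IsPhysical m₁ m₂) :
    (K.diagrams m₁ m₂).HasInvariants K.q K.Qsq (K.s₁ m₂) (K.t₁ m₁) := by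
  have hq : K.q = K.k₂ + K.p - K.k₁ := by rw [← h.conservation]; abel
  have h1 := h.shell_k₁
  have h2 := h.shell_k₂
  have hp := h.shell_p
  constructor <;>
    simp only [Momenta.diagrams, Momenta.Qsq, Momenta.s₁, Momenta.t₁, hq, mdot_add_left,
      mdot_add_right, mdot_sub_left, mdot_sub_right, h1, h2, hp, mdot_comm K.p, mdot_comm K.k₂ K.k₁]
    <;> ring

/-- The contraction of the real hadronic tensor for vector currents with
`α g^{μν} + β k^μ k^ν + γ q^μ q^ν + δ (k^μ q^ν + q^μ k^ν)`, with `k` the momentum of the incoming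
quark. -/
def Diagrams.projectHadron (d : Diagrams) (q : FourVec) (α β γ δ : ℝ) : ℝ :=
  α * d.hadronTrace + β * d.hadron d.k₁ d.k₁ + γ * d.hadron q q
    + δ * (d.hadron d.k₁ q + d.hadron q d.k₁)

theorem triangle_sq_of_nonneg {a b c : ℝ}
    (h : 0 ≤ a ^ 2 + b ^ 2 + c ^ 2 - 2 * a * b - 2 * a * c - 2 * b * c) :
    triangle a b c ^ 2 = a ^ 2 + b ^ 2 + c ^ 2 - 2 * a * b - 2 * a * c - 2 * b * c :=
  Real.sq_sqrt h

theorem triangle_masses_sq (m₁ Q2 z : ℝ) (hQ : 0 ≤ Q2) :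
    triangle (m₁ ^ 2) z (-Q2) ^ 2 = (z + Q2 - m₁ ^ 2) ^ 2 + 4 * m₁ ^ 2 * Q2 := by
  have e : (m₁ ^ 2) ^ 2 + z ^ 2 + (-Q2) ^ 2 - 2 * m₁ ^ 2 * z - 2 * m₁ ^ 2 * (-Q2)
      - 2 * z * (-Q2) = (z + Q2 - m₁ ^ 2) ^ 2 + 4 * m₁ ^ 2 * Q2 := by ring
  rw [triangle_sq_of_nonneg, e]
  rw [e]; positivity

/-- The couplings of a pure vector current. -/
def vectorCouplings : Couplings := ⟨1, 0, 1, 0⟩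

theorem triangle_pow_four (a b c : ℝ) : triangle a b c ^ 4 = (triangle a b c ^ 2) ^ 2 := by ring

set_option maxHeartbeats 4000000 in
/-- The projection of the vector contribution onto the fourth structure function, after all
Minkowski products have been expressed through `Q²`, `ŝ₁`, `t̂₁` and the masses. The quantity `E'`
is `Δ'²`, and the arguments after `q` are the coefficients of the projector: of
`g`, of `P P`, of `q q` and of the symmetrized `P q`. -/
theorem projectHadron₄ {d : Diagrams} {q : FourVec} {Q2 s t : ℝ}
    (h : d.HasInvariants q Q2 s t) (hQ : 0 ≤ Q2) (hs : s ≠ 0) (ht : t ≠ 0) {E' : ℝ}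
    (hE' : E' = (s + d.m₂ ^ 2 + Q2 - d.m₁ ^ 2) ^ 2 + 4 * d.m₁ ^ 2 * Q2) (hE0 : E' ≠ 0) :
    -4 * d.projectHadron q (2 * Q2 / E' * d.m₁ ^ 2)
      (2 * Q2 / E' * (4 / E') * (E' / 2 - 3 * d.m₁ ^ 2 * Q2))
      (2 * Q2 / E' * (4 / E') * (3 * (d.m₁ ^ 2) ^ 2))
      (2 * Q2 / E' * (4 / E') * (-3 * d.m₁ ^ 2 * ((Q2 - d.m₁ ^ 2 + d.m₂ ^ 2 + s) / 2))) =
      explicitF₄ vectorCouplings d.m₁ d.m₂ Q2 s (1 / t ^ 2) (1 / t) t := by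
  simp only [Diagrams.projectHadron, Diagrams.hadronTrace, Diagrams.hadron, dot₆, dot₄,
    explicitF₄, vectorCouplings, Couplings.qPlus, Couplings.qMinus, triangle_pow_four]
  simp only [triangle_masses_sq _ _ _ hQ]
  rw [← hE']
  simp only [mdot_comm d.k₂ d.k₁, mdot_comm d.l₂ d.k₁, mdot_comm d.l₁ d.k₁,
    mdot_comm d.l₁ d.l₂, mdot_comm q d.k₁, mdot_comm q d.l₂, mdot_comm q d.l₁]
  simp only [h.k₁k₁, h.l₂l₂, h.l₁l₁, h.qq, h.k₁k₂, h.k₁l₂, h.k₁l₁, h.k₁q, h.k₂l₂, h.k₂l₁,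
    h.k₂q, h.l₂l₁, h.l₂q, h.l₁q, h.x_eq, h.y_eq]
  generalize d.m₁ = m₁ at *
  generalize d.m₂ = m₂ at *
  field_simp
  subst hE'
  ring

set_option maxHeartbeats 4000000 in
/-- The analogue of `projectHadron₄` for the fifth structure function, with `w = P · q`, so that
`Q² / x̂ = 2 w`. -/
theorem projectHadron₅ {d : Diagrams} {q : FourVec} {Q2 s t : ℝ}
    (h : d.HasInvariants q Q2 s t) (hQ : 0 ≤ Q2) (hs : s ≠ 0) (ht : t ≠ 0) {E' w xhat : ℝ}
    (hE' : E' = (s + d.m₂ ^ 2 + Q2 - d.m₁ ^ 2) ^ 2 + 4 * d.m₁ ^ 2 * Q2) (hE0 : E' ≠ 0)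
    (hw : w = (Q2 - d.m₁ ^ 2 + d.m₂ ^ 2 + s) / 2) (hx : Q2 / xhat = 2 * w) :
    -4 * d.projectHadron q (-(4 * w / E') * w)
      (-(4 * w / E') * (-(12 / E') * (Q2 * w)))
      (-(4 * w / E') * (-(12 / E') * (-d.m₁ ^ 2 * w)))
      (-(4 * w / E') * (-(12 / E') * (E' / 6 - Q2 * d.m₁ ^ 2))) =
      explicitF₅ vectorCouplings d.m₁ d.m₂ Q2 xhat s (1 / t ^ 2) (1 / t) t := by
  simp only [Diagrams.projectHadron, Diagrams.hadronTrace, Diagrams.hadron, dot₆, dot₄,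
    explicitF₅, vectorCouplings, Couplings.qPlus, Couplings.qMinus, triangle_pow_four]
  simp only [triangle_masses_sq _ _ _ hQ]
  rw [← hE', ← div_div, hx]
  simp only [mdot_comm d.k₂ d.k₁, mdot_comm d.l₂ d.k₁, mdot_comm d.l₁ d.k₁,
    mdot_comm d.l₁ d.l₂, mdot_comm q d.k₁, mdot_comm q d.l₂, mdot_comm q d.l₁]
  simp only [h.k₁k₁, h.l₂l₂, h.l₁l₁, h.qq, h.k₁k₂, h.k₁l₂, h.k₁l₁, h.k₁q, h.k₂l₂, h.k₂l₁,
    h.k₂q, h.l₂l₁, h.l₂q, h.l₁q, h.x_eq, h.y_eq]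
  generalize d.m₁ = m₁ at *
  generalize d.m₂ = m₂ at *
  subst hw
  field_simp
  subst hE'
  ring

/-! ### The semi-inclusive structure functions -/

theorem sq_spatial_le {a : FourVec} {m : ℝ} (h : mdot a a = m ^ 2) :
    a 1 ^ 2 + a 2 ^ 2 + a 3 ^ 2 ≤ a 0 ^ 2 := by
  rw [mdot_eq] at h
  nlinarith [sq_nonneg m]

theorem mdot_nonneg {a b : FourVec} (ha : a 1 ^ 2 + a 2 ^ 2 + a 3 ^ 2 ≤ a 0 ^ 2)
    (hb : b 1 ^ 2 + b 2 ^ 2 + b 3 ^ 2 ≤ b 0 ^ 2) (ha0 : 0 < a 0) (hb0 : 0 < b 0) :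
    0 ≤ mdot a b := by
  rw [mdot_eq]
  have h : (a 1 * b 1 + a 2 * b 2 + a 3 * b 3) ^ 2 ≤ (a 0 * b 0) ^ 2 := by
    have h1 : (a 1 * b 1 + a 2 * b 2 + a 3 * b 3) ^ 2 ≤
        (a 1 ^ 2 + a 2 ^ 2 + a 3 ^ 2) * (b 1 ^ 2 + b 2 ^ 2 + b 3 ^ 2) := by
      nlinarith [sq_nonneg (a 1 * b 2 - a 2 * b 1), sq_nonneg (a 1 * b 3 - a 3 * b 1),
        sq_nonneg (a 2 * b 3 - a 3 * b 2)]
    have h2 : (a 1 ^ 2 + a 2 ^ 2 + a 3 ^ 2) * (b 1 ^ 2 + b 2 ^ 2 + b 3 ^ 2) ≤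
        a 0 ^ 2 * b 0 ^ 2 := mul_le_mul ha hb (by positivity) (by positivity)
    rw [mul_pow]; exact h1.trans h2
  have := abs_le_of_sq_le_sq' h (by positivity)
  linarith [this.2]

theorem Momenta.IsPhysical.s₁_nonneg {K : Momenta} {m₁ m₂ : ℝ} (h : K.IsPhysical m₁ m₂) :
    0 ≤ K.s₁ m₂ := by
  have h1 := mdot_nonneg (sq_spatial_le h.shell_k₂)
    (sq_spatial_le (m := 0) (by rw [h.shell_p]; norm_num)) h.energy_k₂ h.energy_p
  rw [Momenta.s₁, h.conservation, mdot_add_left, mdot_add_right, mdot_add_right, h.shell_k₂,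
    h.shell_p, mdot_comm K.p]
  linarith

/-- A four-vector orthogonal to a timelike vector is spacelike. -/
theorem mdot_self_neg_of_orthogonal {a n : FourVec} (ha : 0 < mdot a a) (h : mdot a n = 0)
    (hn : n ≠ 0) : mdot n n < 0 := by
  rw [mdot_eq] at ha h ⊢
  by_contra! hc
  set A := a 1 ^ 2 + a 2 ^ 2 + a 3 ^ 2 with hA
  set B := n 1 ^ 2 + n 2 ^ 2 + n 3 ^ 2 with hB
  have h1 : (a 1 * n 1 + a 2 * n 2 + a 3 * n 3) ^ 2 ≤ A * B := by
    nlinarith [sq_nonneg (a 1 * n 2 - a 2 * n 1), sq_nonneg (a 1 * n 3 - a 3 * n 1),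
      sq_nonneg (a 2 * n 3 - a 3 * n 2)]
  have h2 : a 1 * n 1 + a 2 * n 2 + a 3 * n 3 = a 0 * n 0 := by linarith
  have hA0 : 0 ≤ A := by positivity
  have hBn : B ≤ n 0 ^ 2 := by nlinarith
  have haA : A < a 0 ^ 2 := by nlinarith
  rw [h2] at h1
  have hn0 : n 0 ^ 2 = 0 := by
    by_contra hne
    have : 0 < n 0 ^ 2 := lt_of_le_of_ne (sq_nonneg _) (Ne.symm hne)
    nlinarith
  have hB0 : B ≤ 0 := by linarith
  apply hn
  have e0 : n 0 = 0 := by simpa using hn0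
  have e1 : n 1 = 0 := by nlinarith [sq_nonneg (n 1), sq_nonneg (n 2), sq_nonneg (n 3)]
  have e2 : n 2 = 0 := by nlinarith [sq_nonneg (n 1), sq_nonneg (n 2), sq_nonneg (n 3)]
  have e3 : n 3 = 0 := by nlinarith [sq_nonneg (n 1), sq_nonneg (n 2), sq_nonneg (n 3)]
  ext i; fin_cases i <;> assumption

theorem exists_orthogonal (a b c : FourVec) :
    ∃ n : FourVec, n ≠ 0 ∧ mdot a n = 0 ∧ mdot b n = 0 ∧ mdot c n = 0 := by
  let f : FourVec →ₗ[ℝ] (Fin 3 → ℝ) :=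
    (Matrix.of ![fun μ => metricSign μ * a μ, fun μ => metricSign μ * b μ,
      fun μ => metricSign μ * c μ]).mulVecLin
  have hf : LinearMap.ker f ≠ ⊥ := LinearMap.ker_ne_bot_of_finrank_lt (by simp)
  obtain ⟨n, hn, hn0⟩ := Submodule.exists_mem_ne_zero_of_ne_bot hf
  rw [LinearMap.mem_ker] at hn
  refine ⟨n, hn0, ?_, ?_, ?_⟩
  · exact congrFun hn 0
  · exact congrFun hn 1
  · exact congrFun hn 2

/-- A spacelike vector orthogonal to all momenta of the process. -/
theorem Momenta.IsPhysical.exists_orthogonal {K : Momenta} {m₁ m₂ : ℝ} (h : K.IsPhysical m₁ m₂)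
    (hs : K.s₁ m₂ ≠ 0) :
    ∃ n, mdot n n ≠ 0 ∧ (K.diagrams m₁ m₂).IsOrthogonal n ∧ mdot K.k₁ n = 0 ∧ mdot K.q n = 0 := by
  obtain ⟨n, hn0, h1, h2, h3⟩ := QuarkScattering.exists_orthogonal K.k₁ K.k₂ K.p
  have hP : mdot (K.k₂ + K.p) n = 0 := by rw [mdot_add_left, h2, h3, add_zero]
  have hpos : 0 < mdot (K.k₂ + K.p) (K.k₂ + K.p) := by
    have h5 := lt_of_le_of_ne h.s₁_nonneg (Ne.symm hs)
    rw [Momenta.s₁, h.conservation] at h5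
    nlinarith [sq_nonneg m₂]
  refine ⟨n, (mdot_self_neg_of_orthogonal hpos hP hn0).ne, ⟨h1, h2, hP, ?_⟩, h1, ?_⟩
  · rw [Momenta.diagrams, mdot_sub_left, h1, h3, sub_zero]
  · have hq : K.q = K.k₂ + K.p - K.k₁ := by rw [← h.conservation]; abel
    rw [hq, mdot_sub_left, hP, h1, sub_zero]

theorem tensor_neg_left (d : Diagrams) (Γ Γ' : Matrix (Fin 4) (Fin 4) ℂ) (a b : FourVec) :
    d.tensor (-Γ) Γ' a b = -d.tensor Γ Γ' a b := by
  simp only [Diagrams.tensor, ← neg_one_smul ℂ Γ, Matrix.mul_smul, chainTrace_smul₂,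
    ← Finset.sum_neg_distrib]
  exact Finset.sum_congr rfl fun ρ _ => by ring

theorem tensor_neg_right (d : Diagrams) (Γ Γ' : Matrix (Fin 4) (Fin 4) ℂ) (a b : FourVec) :
    d.tensor Γ (-Γ') a b = -d.tensor Γ Γ' a b := by
  simp only [Diagrams.tensor, ← neg_one_smul ℂ Γ', Matrix.smul_mul, chainTrace_smul₄,
    ← Finset.sum_neg_distrib]
  exact Finset.sum_congr rfl fun ρ _ => by ring

theorem tensor_couplings (d : Diagrams) (V A V' A' : ℂ) (a b : FourVec) :
    d.tensor (V • 1 - A • gammaFive) (V' • 1 + A' • gammaFive) a b =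
      V * V' * d.tensor 1 1 a b + V * A' * d.tensor 1 gammaFive a b
        - A * V' * d.tensor gammaFive 1 a b - A * A' * d.tensor gammaFive gammaFive a b := by
  simp only [Diagrams.tensor, Finset.mul_sum, ← Finset.sum_add_distrib, ← Finset.sum_sub_distrib]
  refine Finset.sum_congr rfl fun ρ _ => ?_
  rw [sub_eq_add_neg, ← neg_smul, Matrix.mul_add, Matrix.add_mul, chainTrace_add₂,
    chainTrace_add₄, chainTrace_add₄]
  simp only [Matrix.mul_smul, Matrix.smul_mul, chainTrace_smul₂, chainTrace_smul₄]
  ring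

theorem project_couplings (d : Diagrams) (V A V' A' : ℂ) (α β γ δ : ℝ) (k q : FourVec) :
    project α β γ δ k q (d.tensor (V • 1 - A • gammaFive) (V' • 1 + A' • gammaFive)) =
      V * V' * project α β γ δ k q (d.tensor 1 1)
        + V * A' * project α β γ δ k q (d.tensor 1 gammaFive)
        - A * V' * project α β γ δ k q (d.tensor gammaFive 1)
        - A * A' * project α β γ δ k q (d.tensor gammaFive gammaFive) := by
  have h : metricTrace (d.tensor (V • 1 - A • gammaFive) (V' • 1 + A' • gammaFive)) =
      V * V' * metricTrace (d.tensor 1 1) + V * A' * metricTrace (d.tensor 1 gammaFive)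
        - A * V' * metricTrace (d.tensor gammaFive 1)
        - A * A' * metricTrace (d.tensor gammaFive gammaFive) := by
    simp only [metricTrace, tensor_couplings, Finset.mul_sum, ← Finset.sum_add_distrib,
      ← Finset.sum_sub_distrib]
    exact Finset.sum_congr rfl fun μ _ => by ring
  rw [project, h]
  simp only [tensor_couplings, project]
  ring

theorem project_tensor_one_one (d : Diagrams) (α β γ δ : ℝ) (q : FourVec) :
    project α β γ δ d.k₁ q (d.tensor 1 1) = ((4 * d.projectHadron q α β γ δ : ℝ) : ℂ) := by
  rw [project, metricTrace_tensor]
  simp only [tensor_one_one]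
  rw [Diagrams.projectHadron]
  push_cast
  ring

theorem project_tensor_gammaFive (d : Diagrams) (α β γ δ : ℝ) (q : FourVec) :
    project α β γ δ d.k₁ q (d.tensor gammaFive gammaFive) =
      -((4 * d.flip.projectHadron q α β γ δ : ℝ) : ℂ) := by
  have h : d.tensor gammaFive gammaFive = fun a b => -d.flip.tensor 1 1 a b := by
    ext a b; exact tensor_gammaFive d a b
  have h1 : project α β γ δ d.k₁ q (d.tensor gammaFive gammaFive) =
      -project α β γ δ d.flip.k₁ q (d.flip.tensor 1 1) := by
    rw [h, project, project]
    simp only [metricTrace, mul_neg, Finset.sum_neg_distrib]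
    simp only [Diagrams.flip]
    ring
  rw [h1, project_tensor_one_one]

/-- The structure function belonging to a projector of the form
`α g^{μν} + β k^μ k^ν + γ q^μ q^ν + δ (k^μ q^ν + q^μ k^ν)`. -/
theorem structureFunction_eq_projectHadron {P : FourVec → FourVec → Fin 4 → Fin 4 → ℝ} {gs : ℝ}
    (hgs : gs ≠ 0) (c : Couplings) {m₁ m₂ : ℝ} {K : Momenta} {S : ExternalStates}
    (hK : K.IsPhysical m₁ m₂) (hS : S.IsFor K m₁ m₂) (hs : K.s₁ m₂ ≠ 0) (ht : K.t₁ m₁ ≠ 0)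
    {α β γ δ : ℝ} (hP : ∀ μ ν, P K.k₁ K.q μ ν = α * metricUp μ ν + β * (K.k₁ μ * K.k₁ ν)
      + γ * (K.q μ * K.q ν) + δ * (K.k₁ μ * K.q ν + K.q μ * K.k₁ ν)) :
    structureFunction P gs c m₁ m₂ K S =
      ((c.V * c.Vp * (-4 * (K.diagrams m₁ m₂).projectHadron K.q α β γ δ)
        + c.A * c.Ap * (-4 * (K.diagrams m₁ m₂).flip.projectHadron K.q α β γ δ) : ℝ) : ℂ) := by
  set d := K.diagrams m₁ m₂ with hd
  have hq : K.k₁ - K.p = K.k₂ - K.q := sub_eq_sub_iff_add_eq_add.mpr hK.conservation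
  have hx : mdot (K.k₂ + K.p) (K.k₂ + K.p) - m₂ ^ 2 ≠ 0 := by
    rw [← hK.conservation]; exact hs
  have hy : mdot (K.k₁ - K.p) (K.k₁ - K.p) - m₁ ^ 2 ≠ 0 := by
    rw [hq]; exact ht
  obtain ⟨n, hn, hdn, hkn, hqn⟩ := hK.exists_orthogonal hs
  rw [structureFunction_eq P hgs c hK hS hx hy]
  have h1 : ∑ μ, ∑ ν, (P K.k₁ K.q μ ν : ℂ) * ∑ ρ, (metricSign ρ : ℂ) *
        d.chainTrace (gammaLow ρ) (currentVertex c.V c.A μ) (gammaLow ρ)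
          (((c.Vp : ℂ) • 1 + (c.Ap : ℂ) • gammaFive) * gammaLow ν) =
      project α β γ δ K.k₁ K.q (d.tensor ((c.V : ℂ) • 1 - (c.A : ℂ) • gammaFive)
        ((c.Vp : ℂ) • 1 + (c.Ap : ℂ) • gammaFive)) := by
    have h2 := sum_mul_eq_project α β γ δ K.k₁ K.q
      (d.tensorLin ((c.V : ℂ) • 1 - (c.A : ℂ) • gammaFive)
        ((c.Vp : ℂ) • 1 + (c.Ap : ℂ) • gammaFive))
    simp only [tensorLin_apply] at h2
    refine Eq.trans ?_ h2
    refine Finset.sum_congr rfl fun μ _ => Finset.sum_congr rfl fun ν _ => ?_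
    rw [hP]
    simp only [Diagrams.tensor, currentVertex, gammaLow_eq_slash]
  rw [h1, project_couplings]
  have z1 := project_tensor_eq_zero (Γ := 1) (Γ' := gammaFive) hn hdn (fun a b => by
    rw [reflectDirac_one hn, reflectDirac_gammaFive hn, tensor_neg_right]) hkn hqn α β γ δ
  have z2 := project_tensor_eq_zero (Γ := gammaFive) (Γ' := 1) hn hdn (fun a b => by
    rw [reflectDirac_one hn, reflectDirac_gammaFive hn, tensor_neg_left]) hkn hqn α β γ δ
  have hk : K.k₁ = d.k₁ := rfl
  rw [z1, z2, hk, project_tensor_one_one, project_tensor_gammaFive]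
  push_cast
  ring

theorem explicitF₄_couplings (c : Couplings) (m₁ m₂ Q2 s a b t : ℝ) :
    explicitF₄ c m₁ m₂ Q2 s a b t =
      c.V * c.Vp * explicitF₄ vectorCouplings m₁ m₂ Q2 s a b t
        + c.A * c.Ap * explicitF₄ vectorCouplings (-m₁) m₂ Q2 s a b t := by
  simp only [explicitF₄, vectorCouplings, Couplings.qPlus, Couplings.qMinus, neg_sq,
    Even.neg_pow (by decide : Even 4)]
  ring

theorem explicitF₅_couplings (c : Couplings) (m₁ m₂ Q2 x s a b t : ℝ) :
    explicitF₅ c m₁ m₂ Q2 x s a b t =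
      c.V * c.Vp * explicitF₅ vectorCouplings m₁ m₂ Q2 x s a b t
        + c.A * c.Ap * explicitF₅ vectorCouplings (-m₁) m₂ Q2 x s a b t := by
  simp only [explicitF₅, vectorCouplings, Couplings.qPlus, Couplings.qMinus, neg_sq,
    Even.neg_pow (by decide : Even 4)]
  ring

theorem Momenta.IsPhysical.triangle_sq {K : Momenta} {m₁ m₂ : ℝ} (h : K.IsPhysical m₁ m₂) :
    triangle (mdot (K.k₁ + K.q) (K.k₁ + K.q)) (mdot K.k₁ K.k₁) (-(-mdot K.q K.q)) ^ 2 =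
      (K.s₁ m₂ + m₂ ^ 2 + K.Qsq - m₁ ^ 2) ^ 2 + 4 * m₁ ^ 2 * K.Qsq := by
  have hQ : 0 < K.Qsq := neg_pos.mpr h.spacelike
  have hq : mdot K.q K.q = -K.Qsq := (neg_neg _).symm
  have hs : mdot (K.k₁ + K.q) (K.k₁ + K.q) = K.s₁ m₂ + m₂ ^ 2 := by rw [Momenta.s₁]; ring
  rw [hs, h.shell_k₁, hq]
  have e : (K.s₁ m₂ + m₂ ^ 2) ^ 2 + (m₁ ^ 2) ^ 2 + (- -(-K.Qsq)) ^ 2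
      - 2 * (K.s₁ m₂ + m₂ ^ 2) * m₁ ^ 2 - 2 * (K.s₁ m₂ + m₂ ^ 2) * (- -(-K.Qsq))
      - 2 * m₁ ^ 2 * (- -(-K.Qsq)) =
      (K.s₁ m₂ + m₂ ^ 2 + K.Qsq - m₁ ^ 2) ^ 2 + 4 * m₁ ^ 2 * K.Qsq := by ring
  rw [triangle_sq_of_nonneg, e]
  rw [e]
  positivity

/-- `Δ'² > 0` above threshold, also for a massless incoming quark. -/
theorem triangle_sq_ne_zero {m₁ m₂ Q2 s : ℝ} (hQ : 0 < Q2) (hs : 0 < s) :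
    (s + m₂ ^ 2 + Q2 - m₁ ^ 2) ^ 2 + 4 * m₁ ^ 2 * Q2 ≠ 0 := by
  by_cases h : m₁ = 0
  · subst h
    have : 0 < s + m₂ ^ 2 + Q2 := by positivity
    simp only [ne_eq, OfNat.ofNat_ne_zero, not_false_eq_true, zero_pow, sub_zero, mul_zero,
      zero_mul, add_zero]
    positivity
  · positivity

theorem structureFunction_projector₄ {gs : ℝ} (hgs : gs ≠ 0) (c : Couplings) {m₁ m₂ : ℝ}
    {K : Momenta} {S : ExternalStates} (hK : K.IsPhysical m₁ m₂) (hS : S.IsFor K m₁ m₂)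
    (hs : K.s₁ m₂ ≠ 0) (ht : K.t₁ m₁ ≠ 0) :
    structureFunction projector₄ gs c m₁ m₂ K S =
      (explicitF₄ c m₁ m₂ K.Qsq (K.s₁ m₂) (1 / K.t₁ m₁ ^ 2) (1 / K.t₁ m₁) (K.t₁ m₁) : ℝ) := by
  have hQ : 0 < K.Qsq := neg_pos.mpr hK.spacelike
  have hs0 : 0 < K.s₁ m₂ := lt_of_le_of_ne hK.s₁_nonneg (Ne.symm hs)
  have hI := hK.hasInvariants
  set d := K.diagrams m₁ m₂ with hd
  set E' := (K.s₁ m₂ + m₂ ^ 2 + K.Qsq - m₁ ^ 2) ^ 2 + 4 * m₁ ^ 2 * K.Qsq with hE'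
  have hE0 : E' ≠ 0 := triangle_sq_ne_zero hQ hs0
  have h1 := projectHadron₄ hI hQ.le hs ht hE' hE0
  have h2 := projectHadron₄ hI.flip (E' := E') hQ.le hs ht
    (by rw [hE', hd]; simp [Diagrams.flip, Momenta.diagrams]) hE0
  have hf : d.flip.m₁ = -m₁ := rfl
  have hf2 : d.flip.m₂ = m₂ := rfl
  have hm : d.m₁ = m₁ := rfl
  have hm2 : d.m₂ = m₂ := rfl
  rw [hf, hf2, neg_sq] at h2
  rw [hm, hm2] at h1
  rw [explicitF₄_couplings, ← h1, ← h2]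
  refine structureFunction_eq_projectHadron hgs c hK hS hs ht fun μ ν => ?_
  have hkq : mdot K.k₁ K.q = (K.Qsq - m₁ ^ 2 + m₂ ^ 2 + K.s₁ m₂) / 2 := hI.k₁q
  have hT := hK.triangle_sq
  rw [hK.shell_k₁, ← hE'] at hT
  rw [projector₄]
  simp only [hK.shell_k₁, hkq, hT]
  change 2 * K.Qsq / E' * (_ + 4 / E' * ((E' / 2 - 3 * m₁ ^ 2 * K.Qsq) * _ + _ - _)) = _
  ring

theorem structureFunction_projector₅ {gs : ℝ} (hgs : gs ≠ 0) (c : Couplings) {m₁ m₂ : ℝ}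
    {K : Momenta} {S : ExternalStates} (hK : K.IsPhysical m₁ m₂) (hS : S.IsFor K m₁ m₂)
    (hs : K.s₁ m₂ ≠ 0) (ht : K.t₁ m₁ ≠ 0) {xhat : ℝ}
    (hx : K.s₁ m₂ = m₁ ^ 2 - m₂ ^ 2 + K.Qsq * (1 / xhat - 1)) :
    structureFunction projector₅ gs c m₁ m₂ K S =
      (explicitF₅ c m₁ m₂ K.Qsq xhat (K.s₁ m₂) (1 / K.t₁ m₁ ^ 2) (1 / K.t₁ m₁) (K.t₁ m₁)
        : ℝ) := by
  have hQ : 0 < K.Qsq := neg_pos.mpr hK.spacelike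
  have hs0 : 0 < K.s₁ m₂ := lt_of_le_of_ne hK.s₁_nonneg (Ne.symm hs)
  have hI := hK.hasInvariants
  set d := K.diagrams m₁ m₂ with hd
  set E' := (K.s₁ m₂ + m₂ ^ 2 + K.Qsq - m₁ ^ 2) ^ 2 + 4 * m₁ ^ 2 * K.Qsq with hE'
  have hE0 : E' ≠ 0 := triangle_sq_ne_zero hQ hs0
  set w := (K.Qsq - m₁ ^ 2 + m₂ ^ 2 + K.s₁ m₂) / 2 with hw
  have hxw : K.Qsq / xhat = 2 * w := by
    rw [hw, hx]; ring
  have h1 := projectHadron₅ hI hQ.le hs ht hE' hE0 hw hxw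
  have h2 := projectHadron₅ hI.flip (E' := E') (w := w) hQ.le hs ht
    (by rw [hE', hd]; simp [Diagrams.flip, Momenta.diagrams]) hE0
    (by rw [hw, hd]; simp [Diagrams.flip, Momenta.diagrams]) hxw
  have hf : d.flip.m₁ = -m₁ := rfl
  have hf2 : d.flip.m₂ = m₂ := rfl
  have hm : d.m₁ = m₁ := rfl
  have hm2 : d.m₂ = m₂ := rfl
  rw [hf, hf2, neg_sq] at h2
  rw [hm, hm2] at h1
  rw [explicitF₅_couplings, ← h1, ← h2]
  refine structureFunction_eq_projectHadron hgs c hK hS hs ht fun μ ν => ?_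
  have hkq : mdot K.k₁ K.q = w := hI.k₁q
  have hT := hK.triangle_sq
  rw [hK.shell_k₁, ← hE'] at hT
  rw [projector₅]
  simp only [hK.shell_k₁, hkq, hT]
  change -(4 * w / E') * (-(12 / E') * (K.Qsq * w * _ - _ + (E' / 6 - K.Qsq * m₁ ^ 2) * _) + _) = _
  ring

/-! ### Kinematics in the centre-of-mass frame -/

theorem inner_spatial (a b : FourVec) :
    inner ℝ (spatial a) (spatial b) = a 1 * b 1 + a 2 * b 2 + a 3 * b 3 := by
  simp [spatial, PiLp.inner_apply, Fin.sum_univ_three]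
  ring

theorem norm_spatial_sq (a : FourVec) : ‖spatial a‖ ^ 2 = a 1 ^ 2 + a 2 ^ 2 + a 3 ^ 2 := by
  rw [← real_inner_self_eq_norm_sq, inner_spatial]; ring

/-- The relation `Δ'² = (Σ₊₊ + ŝ₁)² - 4 m₁² (ŝ₁ + m₂²)`, and the resulting inequalities. -/
theorem triangle_bounds {m₁ m₂ Q2 s₁ : ℝ} (hm₁ : 0 < m₁) (hQ : 0 < Q2) (hs : 0 < s₁) :
    0 < triangle (m₁ ^ 2) (s₁ + m₂ ^ 2) (-Q2) ∧
    triangle (m₁ ^ 2) (s₁ + m₂ ^ 2) (-Q2) ^ 2 =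
      (Q2 + m₂ ^ 2 + m₁ ^ 2 + s₁) ^ 2 - 4 * m₁ ^ 2 * (s₁ + m₂ ^ 2) ∧
    triangle (m₁ ^ 2) (s₁ + m₂ ^ 2) (-Q2) < Q2 + m₂ ^ 2 + m₁ ^ 2 + s₁ := by
  set D := triangle (m₁ ^ 2) (s₁ + m₂ ^ 2) (-Q2) with hD
  have h1 : D ^ 2 = (s₁ + m₂ ^ 2 + Q2 - m₁ ^ 2) ^ 2 + 4 * m₁ ^ 2 * Q2 :=
    triangle_masses_sq m₁ Q2 (s₁ + m₂ ^ 2) hQ.le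
  have h0 : 0 ≤ D := Real.sqrt_nonneg _
  have hpos : 0 < D := by
    refine lt_of_le_of_ne h0 fun h => ?_
    rw [← h] at h1
    have : 0 < 4 * m₁ ^ 2 * Q2 := by positivity
    nlinarith [sq_nonneg (s₁ + m₂ ^ 2 + Q2 - m₁ ^ 2)]
  have h2 : D ^ 2 = (Q2 + m₂ ^ 2 + m₁ ^ 2 + s₁) ^ 2 - 4 * m₁ ^ 2 * (s₁ + m₂ ^ 2) := by
    rw [h1]; ring
  refine ⟨hpos, h2, ?_⟩
  have h3 : 0 < 4 * m₁ ^ 2 * (s₁ + m₂ ^ 2) := by positivity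
  exact lt_of_pow_lt_pow_left₀ 2 (by positivity) (by rw [h2]; linarith)

theorem tOfY_eq {m₁ m₂ Q2 s₁ : ℝ} (hm₁ : 0 < m₁) (hQ : 0 < Q2) (hs : 0 < s₁) (y : ℝ) :
    tOfY m₁ m₂ Q2 s₁ y = s₁ * triangle (m₁ ^ 2) (s₁ + m₂ ^ 2) (-Q2) / (s₁ + m₂ ^ 2) * y
      + -(s₁ * (Q2 + m₂ ^ 2 + m₁ ^ 2 + s₁ + triangle (m₁ ^ 2) (s₁ + m₂ ^ 2) (-Q2))
        / (2 * (s₁ + m₂ ^ 2))) := by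
  have hD := (triangle_bounds (m₂ := m₂) hm₁ hQ hs).1
  have hs' : 0 < s₁ + m₂ ^ 2 := by positivity
  simp only [tOfY]
  field_simp
  ring

theorem Momenta.IsCM.t₁_eq {K : Momenta} {m₁ m₂ Q2 s₁ y : ℝ} (h : K.IsCM m₁ m₂ Q2 s₁ y)
    (hm₁ : 0 < m₁) (hQ : 0 < Q2) (hs : 0 < s₁) : K.t₁ m₁ = tOfY m₁ m₂ Q2 s₁ y := by
  have hK := h.physical
  have hI := hK.hasInvariants
  have hcons := hK.conservation
  obtain ⟨hD, hD2, -⟩ := triangle_bounds (m₂ := m₂) hm₁ hQ hs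
  rw [tOfY_eq hm₁ hQ hs]
  set D := triangle (m₁ ^ 2) (s₁ + m₂ ^ 2) (-Q2) with hDdef
  set A := Q2 + m₂ ^ 2 + m₁ ^ 2 + s₁ with hA
  have hs' : 0 < s₁ + m₂ ^ 2 := by positivity
  -- spatial components in the centre-of-mass frame
  have hf : ∀ i : Fin 3, (spatial (K.k₂ + K.p)) i = 0 := by
    intro i; rw [← hcons, h.frame]; rfl
  have f1 : K.p 1 = -K.k₂ 1 := by have := hf 0; simp [spatial] at this; linarith
  have f2 : K.p 2 = -K.k₂ 2 := by have := hf 1; simp [spatial] at this; linarith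
  have f3 : K.p 3 = -K.k₂ 3 := by have := hf 2; simp [spatial] at this; linarith
  set W := K.k₂ 0 + K.p 0 with hW
  have hW0 : 0 < W := add_pos hK.energy_k₂ hK.energy_p
  have hWW : W ^ 2 = s₁ + m₂ ^ 2 := by
    have := hI.l₂l₂
    simp only [Momenta.diagrams, h.energy, mdot_eq, Pi.add_apply, f1, f2, f3] at this
    rw [← this]; ring
  have hWk : W * K.k₁ 0 = A / 2 := by
    have := hI.k₁l₂
    simp only [Momenta.diagrams, h.energy, h.virtuality, mdot_eq, Pi.add_apply, f1, f2, f3] at this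
    rw [hA]; linarith
  have hWp : W * K.p 0 = s₁ / 2 := by
    have e1 := hI.k₂l₂
    have e2 := hI.l₂l₂
    simp only [Momenta.diagrams, h.energy, mdot_eq, Pi.add_apply, f1, f2, f3] at e1 e2
    rw [hW]; linarith
  have hk1 : W * ‖spatial K.k₁‖ = D / 2 := by
    have h1 : (W * ‖spatial K.k₁‖) ^ 2 = (D / 2) ^ 2 := by
      have h2 := hK.shell_k₁
      rw [mdot_eq] at h2
      have h3 : (W * K.k₁ 0) ^ 2 = (A / 2) ^ 2 := by rw [hWk]
      rw [mul_pow, norm_spatial_sq, div_pow, hD2]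
      linear_combination h3 - W ^ 2 * h2 - m₁ ^ 2 * hWW
    exact (pow_left_inj₀ (by positivity) (by positivity) two_ne_zero).mp h1
  have hk2 : ‖spatial K.k₂‖ = K.p 0 := by
    have h1 : ‖spatial K.k₂‖ ^ 2 = K.p 0 ^ 2 := by
      have h2 := hK.shell_p
      rw [mdot_eq, f1, f2, f3] at h2
      rw [norm_spatial_sq]; linarith
    exact (pow_left_inj₀ (by positivity) hK.energy_p.le two_ne_zero).mp h1
  have hcos := InnerProductGeometry.cos_angle_mul_norm_mul_norm (spatial K.k₂) (spatial K.k₁)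
  have hy : Real.cos (InnerProductGeometry.angle (spatial K.k₂) (spatial K.k₁)) = 1 - 2 * y := by
    rw [h.angle]; ring
  rw [hy, inner_spatial, hk2] at hcos
  have ht : K.t₁ m₁ = -2 * (K.k₁ 0 * K.p 0 + (1 - 2 * y) * (K.p 0 * ‖spatial K.k₁‖)) := by
    have e1 := hI.k₁k₂
    have e2 := hI.k₁l₂
    have e3 : mdot K.k₁ (K.k₂ + K.p) = mdot K.k₁ K.k₂ + mdot K.k₁ K.p := mdot_add_right _ _ _
    have e4 : mdot K.k₁ K.p = -K.t₁ m₁ / 2 := by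
      simp only [Momenta.diagrams] at e1 e2
      rw [e3, e1] at e2
      linarith
    rw [mdot_eq, f1, f2, f3] at e4
    rw [hcos]; linarith
  have key : (s₁ + m₂ ^ 2) * K.t₁ m₁ = -2 * (A / 2 * (s₁ / 2)
      + (1 - 2 * y) * (s₁ / 2 * (D / 2))) := by
    rw [← hWW, ht, ← hWk, ← hWp, ← hk1]; ring
  field_simp
  linear_combination 2 * key

theorem exists_isCM {m₁ m₂ Q2 s₁ y : ℝ} (hm₁ : 0 < m₁) (hQ : 0 < Q2) (hs : 0 < s₁)
    (hy : y ∈ Set.Icc (0 : ℝ) 1) : ∃ K : Momenta, K.IsCM m₁ m₂ Q2 s₁ y := by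
  obtain ⟨hD, hD2, -⟩ := triangle_bounds (m₂ := m₂) hm₁ hQ hs
  set D := triangle (m₁ ^ 2) (s₁ + m₂ ^ 2) (-Q2) with hDdef
  have hs' : 0 < s₁ + m₂ ^ 2 := by positivity
  set W := Real.sqrt (s₁ + m₂ ^ 2) with hW
  have hW0 : 0 < W := Real.sqrt_pos.mpr hs'
  have hWW : W ^ 2 = s₁ + m₂ ^ 2 := Real.sq_sqrt hs'.le
  -- `W` is the total energy, `c` and `σ` are the cosine and sine of the scattering angle, `E` and
  -- `κ` the energy and momentum of the incoming quark, and `r` the momentum of the outgoing one.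
  set c := 1 - 2 * y with hc
  set σ := 2 * Real.sqrt (y * (1 - y)) with hσ
  have hσ2 : σ ^ 2 = 1 - c ^ 2 := by
    rw [hσ, mul_pow, Real.sq_sqrt (mul_nonneg hy.1 (by linarith [hy.2])), hc]; ring
  set E := (Q2 + m₂ ^ 2 + m₁ ^ 2 + s₁) / (2 * W) with hE
  set κ := D / (2 * W) with hκ
  set r := s₁ / (2 * W) with hr
  have hE0 : 0 < E := by positivity
  have hκ0 : 0 < κ := by positivity
  have hr0 : 0 < r := by positivity
  have hEκ : E ^ 2 - κ ^ 2 = m₁ ^ 2 := by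
    rw [hE, hκ, div_pow, div_pow, hD2, mul_pow, hWW]; field_simp; ring
  have hWE : W * E = (Q2 + m₂ ^ 2 + m₁ ^ 2 + s₁) / 2 := by rw [hE]; field_simp
  have hWr : W * r = s₁ / 2 := by rw [hr]; field_simp
  have hrW : 0 < W - r := by
    have : 0 < W * (W - r) := by
      have : W * (W - r) = s₁ / 2 + m₂ ^ 2 := by linear_combination hWW - hWr
      rw [this]; positivity
    exact pos_of_mul_pos_right this hW0.le
  refine ⟨⟨![E, κ, 0, 0], ![W - E, -κ, 0, 0], ![W - r, r * c, r * σ, 0],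
    ![r, -(r * c), -(r * σ), 0]⟩, ⟨⟨?_, ?_, ?_, ?_, ?_, ?_, ?_, ?_⟩, ?_, ?_, ?_, ?_⟩⟩
  · ext i; fin_cases i <;> simp
  · simp [mdot_eq]; linear_combination hEκ
  · simp [mdot_eq]; linear_combination hWW - 2 * hWr - r ^ 2 * hσ2
  · simp [mdot_eq]; linear_combination -r ^ 2 * hσ2
  · simpa using hE0
  · simpa using hrW
  · simpa using hr0
  · have : mdot ![W - E, -κ, 0, 0] ![W - E, -κ, 0, 0] = -Q2 := by
      simp [mdot_eq]; linear_combination hWW - 2 * hWE + hEκ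
    change mdot ![W - E, -κ, 0, 0] ![W - E, -κ, 0, 0] < 0
    rw [this]; linarith
  · simp [Momenta.Qsq, mdot_eq]; linear_combination -hWW + 2 * hWE - hEκ
  · simp [Momenta.s₁, mdot_eq]; linear_combination hWW
  · ext i; fin_cases i <;> simp [spatial]
  · have hcos := InnerProductGeometry.cos_angle_mul_norm_mul_norm
      (spatial ![W - r, r * c, r * σ, 0]) (spatial ![E, κ, 0, 0])
    have n1 : ‖spatial ![W - r, r * c, r * σ, 0]‖ = r := by
      refine (pow_left_inj₀ (norm_nonneg _) hr0.le two_ne_zero).mp ?_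
      rw [norm_spatial_sq]; simp; linear_combination r ^ 2 * hσ2
    have n2 : ‖spatial ![E, κ, 0, 0]‖ = κ := by
      refine (pow_left_inj₀ (norm_nonneg _) hκ0.le two_ne_zero).mp ?_
      rw [norm_spatial_sq]; simp
    rw [n1, n2, inner_spatial] at hcos
    simp at hcos
    have hcc : Real.cos (InnerProductGeometry.angle (spatial ![W - r, r * c, r * σ, 0])
        (spatial ![E, κ, 0, 0])) = c := by
      have hrk : r * κ ≠ 0 := by positivity
      apply mul_right_cancel₀ hrk
      rw [hcos]; ring
    change y = (1 - Real.cos (InnerProductGeometry.angle (spatial ![W - r, r * c, r * σ, 0])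
        (spatial ![E, κ, 0, 0]))) / 2
    rw [hcc, hc]; ring

/-! ### Integration over the polar angle -/

theorem tOfY_neg {m₁ m₂ Q2 s₁ y : ℝ} (hm₁ : 0 < m₁) (hQ : 0 < Q2) (hs : 0 < s₁) (hy : y ≤ 1) :
    tOfY m₁ m₂ Q2 s₁ y < 0 := by
  obtain ⟨hD, -, hDA⟩ := triangle_bounds (m₂ := m₂) hm₁ hQ hs
  rw [tOfY_eq hm₁ hQ hs]
  set D := triangle (m₁ ^ 2) (s₁ + m₂ ^ 2) (-Q2) with hDdef
  set A := Q2 + m₂ ^ 2 + m₁ ^ 2 + s₁ with hA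
  have hs' : 0 < s₁ + m₂ ^ 2 := by positivity
  have e : s₁ * D / (s₁ + m₂ ^ 2) * y + -(s₁ * (A + D) / (2 * (s₁ + m₂ ^ 2))) =
      -(s₁ * ((A - D) + 2 * D * (1 - y)) / (2 * (s₁ + m₂ ^ 2))) := by
    field_simp; ring
  rw [e, neg_lt_zero]
  have : 0 < (A - D) + 2 * D * (1 - y) :=
    add_pos_of_pos_of_nonneg (sub_pos.mpr hDA) (by have := sub_nonneg.mpr hy; positivity)
  positivity

theorem continuous_tOfY (m₁ m₂ Q2 s₁ : ℝ) : Continuous (tOfY m₁ m₂ Q2 s₁) := by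
  unfold tOfY; fun_prop

theorem intervalIntegrable_inv_tOfY {m₁ m₂ Q2 s₁ : ℝ} (hm₁ : 0 < m₁) (hQ : 0 < Q2) (hs : 0 < s₁) :
    IntervalIntegrable (fun y => 1 / tOfY m₁ m₂ Q2 s₁ y) MeasureTheory.volume 0 1 := by
  refine ContinuousOn.intervalIntegrable fun y hy => ?_
  rw [Set.uIcc_of_le zero_le_one] at hy
  exact (continuousAt_const.div (continuous_tOfY m₁ m₂ Q2 s₁).continuousAt
    (tOfY_neg hm₁ hQ hs hy.2).ne).continuousWithinAt

theorem intervalIntegrable_inv_tOfY_sq {m₁ m₂ Q2 s₁ : ℝ} (hm₁ : 0 < m₁) (hQ : 0 < Q2)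
    (hs : 0 < s₁) :
    IntervalIntegrable (fun y => 1 / tOfY m₁ m₂ Q2 s₁ y ^ 2) MeasureTheory.volume 0 1 := by
  refine ContinuousOn.intervalIntegrable fun y hy => ?_
  rw [Set.uIcc_of_le zero_le_one] at hy
  exact (continuousAt_const.div ((continuous_tOfY m₁ m₂ Q2 s₁).pow 2).continuousAt
    (pow_ne_zero 2 (tOfY_neg hm₁ hQ hs hy.2).ne)).continuousWithinAt

theorem integral_tOfY {m₁ m₂ Q2 s₁ : ℝ} (hm₁ : 0 < m₁) (hQ : 0 < Q2) (hs : 0 < s₁) :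
    ∫ y in (0 : ℝ)..1, tOfY m₁ m₂ Q2 s₁ y = substT m₁ m₂ Q2 s₁ := by
  have hs' : 0 < s₁ + m₂ ^ 2 := by positivity
  have h : ∀ a b : ℝ, ∫ y in (0 : ℝ)..1, (a * y + b) = a / 2 + b := by
    intro a b
    have i1 : IntervalIntegrable (fun y : ℝ => a * y) MeasureTheory.volume 0 1 :=
      (by fun_prop : Continuous fun y : ℝ => a * y).intervalIntegrable _ _
    rw [intervalIntegral.integral_add i1 intervalIntegrable_const,
      intervalIntegral.integral_const_mul, integral_id, intervalIntegral.integral_const]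
    simp
    ring
  simp only [tOfY_eq hm₁ hQ hs]
  rw [h, substT]
  field_simp
  ring

theorem integral_inv_tOfY {m₁ m₂ Q2 s₁ : ℝ} (hm₁ : 0 < m₁) (hQ : 0 < Q2) (hs : 0 < s₁) :
    ∫ y in (0 : ℝ)..1, 1 / tOfY m₁ m₂ Q2 s₁ y = substInv m₁ m₂ Q2 s₁ := by
  obtain ⟨hD, -, hDA⟩ := triangle_bounds (m₂ := m₂) hm₁ hQ hs
  have hs' : 0 < s₁ + m₂ ^ 2 := by positivity
  have h0 := tOfY_neg (m₂ := m₂) hm₁ hQ hs zero_le_one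
  have h1 := tOfY_neg (m₂ := m₂) hm₁ hQ hs le_rfl
  rw [tOfY_eq hm₁ hQ hs] at h0 h1
  simp only [tOfY_eq hm₁ hQ hs]
  rw [substInv, logTerm]
  set D := triangle (m₁ ^ 2) (s₁ + m₂ ^ 2) (-Q2) with hDdef
  set A := Q2 + m₂ ^ 2 + m₁ ^ 2 + s₁ with hA
  have ha : s₁ * D / (s₁ + m₂ ^ 2) ≠ 0 := by positivity
  have hAD : 0 < A + D := by positivity
  rw [intervalIntegral.integral_comp_mul_add (fun x => 1 / x) ha, integral_one_div_of_neg h0 h1,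
    smul_eq_mul, inv_div]
  congr 2
  have : s₁ * D / (s₁ + m₂ ^ 2) * 0 + -(s₁ * (A + D) / (2 * (s₁ + m₂ ^ 2))) ≠ 0 := h0.ne
  rw [div_eq_div_iff this hAD.ne']
  field_simp
  ring

theorem integral_inv_tOfY_sq {m₁ m₂ Q2 s₁ : ℝ} (hm₁ : 0 < m₁) (hQ : 0 < Q2) (hs : 0 < s₁) :
    ∫ y in (0 : ℝ)..1, 1 / tOfY m₁ m₂ Q2 s₁ y ^ 2 = substInvSq m₁ m₂ s₁ := by
  obtain ⟨hD, hD2, hDA⟩ := triangle_bounds (m₂ := m₂) hm₁ hQ hs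
  have hs' : 0 < s₁ + m₂ ^ 2 := by positivity
  have hI := intervalIntegrable_inv_tOfY_sq (m₂ := m₂) hm₁ hQ hs
  have hneg := fun y (hy : y ≤ 1) => tOfY_neg (m₂ := m₂) hm₁ hQ hs hy
  simp only [tOfY_eq hm₁ hQ hs] at hI hneg ⊢
  rw [substInvSq]
  set D := triangle (m₁ ^ 2) (s₁ + m₂ ^ 2) (-Q2) with hDdef
  set A := Q2 + m₂ ^ 2 + m₁ ^ 2 + s₁ with hA
  set a := s₁ * D / (s₁ + m₂ ^ 2) with ha
  set b := -(s₁ * (A + D) / (2 * (s₁ + m₂ ^ 2))) with hb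
  have ha0 : a ≠ 0 := by positivity
  have hder : ∀ y ∈ Set.uIcc (0 : ℝ) 1,
      HasDerivAt (fun y => -(a⁻¹ * (a * y + b)⁻¹)) (1 / (a * y + b) ^ 2) y := by
    intro y hy
    rw [Set.uIcc_of_le zero_le_one] at hy
    have hne := (hneg y hy.2).ne
    have h1 : HasDerivAt (fun y => a * y + b) a y := by
      simpa using ((hasDerivAt_id y).const_mul a).add_const b
    have h2 := ((h1.inv hne).const_mul a⁻¹).neg
    have e : 1 / (a * y + b) ^ 2 = -(a⁻¹ * (-a / (a * y + b) ^ 2)) := by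
      rw [neg_div, mul_neg, neg_neg, ← mul_div_assoc, inv_mul_cancel₀ ha0]
    rw [e]
    exact h2
  rw [intervalIntegral.integral_eq_sub_of_hasDerivAt hder hI]
  have h0 : b ≠ 0 := by have := (hneg 0 zero_le_one).ne; simpa using this
  have h1 : a + b ≠ 0 := by have := (hneg 1 le_rfl).ne; simpa using this
  have hprod : b * (a + b) = s₁ ^ 2 * m₁ ^ 2 / (s₁ + m₂ ^ 2) := by
    rw [ha, hb]
    field_simp
    linear_combination -hD2
  have e : -(a⁻¹ * (a * 1 + b)⁻¹) - -(a⁻¹ * (a * 0 + b)⁻¹) = 1 / (b * (a + b)) := by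
    rw [mul_one, mul_zero, zero_add]; field_simp; ring
  rw [e, hprod]
  field_simp

/-- The integral over the polar angle of a function that is affine in `1 / t̂₁²`, `1 / t̂₁` and
`t̂₁` is obtained by substitution. -/
theorem integral_affine {m₁ m₂ Q2 s₁ : ℝ} (hm₁ : 0 < m₁) (hQ : 0 < Q2) (hs : 0 < s₁)
    {F : ℝ → ℝ → ℝ → ℝ} {C₀ C₁ C₂ C₃ : ℝ}
    (hF : ∀ a b t, F a b t = C₀ + C₁ * a + C₂ * b + C₃ * t) {f : ℝ → ℂ}
    (hf : ∀ y ∈ Set.Icc (0 : ℝ) 1, f y = (F (1 / tOfY m₁ m₂ Q2 s₁ y ^ 2)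
      (1 / tOfY m₁ m₂ Q2 s₁ y) (tOfY m₁ m₂ Q2 s₁ y) : ℝ)) :
    IntervalIntegrable f MeasureTheory.volume 0 1 ∧
    ∫ y in (0 : ℝ)..1, f y =
      (F (substInvSq m₁ m₂ s₁) (substInv m₁ m₂ Q2 s₁) (substT m₁ m₂ Q2 s₁) : ℝ) := by
  set g : ℝ → ℝ := fun y => C₀ + C₁ * (1 / tOfY m₁ m₂ Q2 s₁ y ^ 2)
    + C₂ * (1 / tOfY m₁ m₂ Q2 s₁ y) + C₃ * tOfY m₁ m₂ Q2 s₁ y with hg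
  have i0 : IntervalIntegrable (fun _ : ℝ => C₀) MeasureTheory.volume 0 1 :=
    intervalIntegrable_const
  have i1 := (intervalIntegrable_inv_tOfY_sq (m₂ := m₂) hm₁ hQ hs).const_mul C₁
  have i2 := (intervalIntegrable_inv_tOfY (m₂ := m₂) hm₁ hQ hs).const_mul C₂
  have i3 := ((continuous_tOfY m₁ m₂ Q2 s₁).intervalIntegrable (μ := MeasureTheory.volume)
    0 1).const_mul C₃
  have hgi : IntervalIntegrable g MeasureTheory.volume 0 1 := ((i0.add i1).add i2).add i3
  have hfg : ∀ y ∈ Set.uIcc (0 : ℝ) 1, f y = ((g y : ℝ) : ℂ) := by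
    intro y hy
    rw [Set.uIcc_of_le zero_le_one] at hy
    rw [hf y hy, hF]
  constructor
  · have h1 : IntervalIntegrable (fun y => ((g y : ℝ) : ℂ)) MeasureTheory.volume 0 1 :=
      ⟨hgi.1.ofReal, hgi.2.ofReal⟩
    refine h1.congr fun y hy => (hfg y ?_).symm
    exact Set.uIoc_subset_uIcc hy
  · rw [intervalIntegral.integral_congr hfg, intervalIntegral.integral_ofReal, hF]
    congr 1
    rw [hg, intervalIntegral.integral_add ((i0.add i1).add i2) i3,
      intervalIntegral.integral_add (i0.add i1) i2, intervalIntegral.integral_add i0 i1]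
    simp only [intervalIntegral.integral_const_mul]
    rw [integral_inv_tOfY_sq hm₁ hQ hs, integral_inv_tOfY hm₁ hQ hs, integral_tOfY hm₁ hQ hs]
    simp

theorem explicitF₄_affine (c : Couplings) (m₁ m₂ Q2 s₁ : ℝ) :
    ∃ C₀ C₁ C₂ C₃ : ℝ, ∀ a b t, explicitF₄ c m₁ m₂ Q2 s₁ a b t = C₀ + C₁ * a + C₂ * b + C₃ * t := by
  -- The coefficients of an affine function come from its values at `0` and the unit vectors.
  refine ⟨explicitF₄ c m₁ m₂ Q2 s₁ 0 0 0,
    explicitF₄ c m₁ m₂ Q2 s₁ 1 0 0 - explicitF₄ c m₁ m₂ Q2 s₁ 0 0 0,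
    explicitF₄ c m₁ m₂ Q2 s₁ 0 1 0 - explicitF₄ c m₁ m₂ Q2 s₁ 0 0 0,
    explicitF₄ c m₁ m₂ Q2 s₁ 0 0 1 - explicitF₄ c m₁ m₂ Q2 s₁ 0 0 0, fun a b t => ?_⟩
  simp only [explicitF₄]
  ring

theorem explicitF₅_affine (c : Couplings) (m₁ m₂ Q2 x s₁ : ℝ) :
    ∃ C₀ C₁ C₂ C₃ : ℝ, ∀ a b t,
      explicitF₅ c m₁ m₂ Q2 x s₁ a b t = C₀ + C₁ * a + C₂ * b + C₃ * t := by
  refine ⟨explicitF₅ c m₁ m₂ Q2 x s₁ 0 0 0,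
    explicitF₅ c m₁ m₂ Q2 x s₁ 1 0 0 - explicitF₅ c m₁ m₂ Q2 x s₁ 0 0 0,
    explicitF₅ c m₁ m₂ Q2 x s₁ 0 1 0 - explicitF₅ c m₁ m₂ Q2 x s₁ 0 0 0,
    explicitF₅ c m₁ m₂ Q2 x s₁ 0 0 1 - explicitF₅ c m₁ m₂ Q2 x s₁ 0 0 0, fun a b t => ?_⟩
  simp only [explicitF₅]
  ring

end QuarkScattering

end

theorem mainTheorem2 (gs : ℝ) (hgs : gs ≠ 0) (c : Couplings) (m₁ m₂ : ℝ)
    (hm₁ : 0 ≤ m₁) (hm₂ : 0 ≤ m₂) :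
    -- the semi-inclusive structure functions
    (∀ (K : Momenta) (S : ExternalStates),
      K.IsPhysical m₁ m₂ → S.IsFor K m₁ m₂ → K.s₁ m₂ ≠ 0 → K.t₁ m₁ ≠ 0 →
        structureFunction projector₄ gs c m₁ m₂ K S =
            (explicitF₄ c m₁ m₂ K.Qsq (K.s₁ m₂)
              (1 / K.t₁ m₁ ^ 2) (1 / K.t₁ m₁) (K.t₁ m₁) : ℝ) ∧
        ∀ xhat : ℝ, xhat ≠ 0 → K.s₁ m₂ = m₁ ^ 2 - m₂ ^ 2 + K.Qsq * (1 / xhat - 1) →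
          structureFunction projector₅ gs c m₁ m₂ K S =
            (explicitF₅ c m₁ m₂ K.Qsq xhat (K.s₁ m₂)
              (1 / K.t₁ m₁ ^ 2) (1 / K.t₁ m₁) (K.t₁ m₁) : ℝ)) ∧
    -- the inclusive structure functions
    (0 < m₁ → ∀ Q2 s₁ : ℝ, 0 < Q2 → 0 < s₁ →
      (∀ y ∈ Set.Icc (0 : ℝ) 1,
        (∃ K : Momenta, K.IsCM m₁ m₂ Q2 s₁ y) ∧
        ∀ K : Momenta, K.IsCM m₁ m₂ Q2 s₁ y → K.t₁ m₁ = tOfY m₁ m₂ Q2 s₁ y) ∧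
      (∫ y in (0 : ℝ)..1, 1 / tOfY m₁ m₂ Q2 s₁ y ^ 2) = substInvSq m₁ m₂ s₁ ∧
      (∫ y in (0 : ℝ)..1, 1 / tOfY m₁ m₂ Q2 s₁ y) = substInv m₁ m₂ Q2 s₁ ∧
      (∫ y in (0 : ℝ)..1, tOfY m₁ m₂ Q2 s₁ y) = substT m₁ m₂ Q2 s₁ ∧
      ∀ (K : ℝ → Momenta) (S : ℝ → ExternalStates),
        (∀ y ∈ Set.Icc (0 : ℝ) 1, (K y).IsCM m₁ m₂ Q2 s₁ y ∧ (S y).IsFor (K y) m₁ m₂) →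
          (IntervalIntegrable (fun y => structureFunction projector₄ gs c m₁ m₂ (K y) (S y))
              MeasureTheory.volume 0 1 ∧
            (∫ y in (0 : ℝ)..1, structureFunction projector₄ gs c m₁ m₂ (K y) (S y)) =
              (explicitF₄ c m₁ m₂ Q2 s₁
                (substInvSq m₁ m₂ s₁) (substInv m₁ m₂ Q2 s₁) (substT m₁ m₂ Q2 s₁) : ℝ)) ∧
          ∀ xhat : ℝ, xhat ≠ 0 → s₁ = m₁ ^ 2 - m₂ ^ 2 + Q2 * (1 / xhat - 1) →
            IntervalIntegrable (fun y => structureFunction projector₅ gs c m₁ m₂ (K y) (S y))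
              MeasureTheory.volume 0 1 ∧
            (∫ y in (0 : ℝ)..1, structureFunction projector₅ gs c m₁ m₂ (K y) (S y)) =
              (explicitF₅ c m₁ m₂ Q2 xhat s₁
                (substInvSq m₁ m₂ s₁) (substInv m₁ m₂ Q2 s₁) (substT m₁ m₂ Q2 s₁) : ℝ)) := by
  refine ⟨fun K S hK hS hs ht => ⟨structureFunction_projector₄ hgs c hK hS hs ht,
    fun xhat _ hx => structureFunction_projector₅ hgs c hK hS hs ht hx⟩, fun hm Q2 s₁ hQ hs =>
    ⟨fun y hy => ⟨exists_isCM hm hQ hs hy, fun K hK => hK.t₁_eq hm hQ hs⟩,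
      integral_inv_tOfY_sq hm hQ hs, integral_inv_tOfY hm hQ hs, integral_tOfY hm hQ hs,
      fun K S hKS => ?_⟩⟩
  have ht : ∀ y ∈ Set.Icc (0 : ℝ) 1, (K y).t₁ m₁ = tOfY m₁ m₂ Q2 s₁ y := fun y hy =>
    (hKS y hy).1.t₁_eq hm hQ hs
  have ht0 : ∀ y ∈ Set.Icc (0 : ℝ) 1, (K y).t₁ m₁ ≠ 0 := fun y hy => by
    rw [ht y hy]; exact (tOfY_neg hm hQ hs hy.2).ne
  have hs0 : ∀ y ∈ Set.Icc (0 : ℝ) 1, (K y).s₁ m₂ ≠ 0 := fun y hy => by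
    rw [(hKS y hy).1.energy]; exact hs.ne'
  refine ⟨?_, fun xhat _ hx => ?_⟩
  · obtain ⟨C₀, C₁, C₂, C₃, hC⟩ := explicitF₄_affine c m₁ m₂ Q2 s₁
    refine integral_affine hm hQ hs hC fun y hy => ?_
    rw [structureFunction_projector₄ hgs c (hKS y hy).1.physical (hKS y hy).2 (hs0 y hy)
      (ht0 y hy), ht y hy, (hKS y hy).1.energy, (hKS y hy).1.virtuality]
  · obtain ⟨C₀, C₁, C₂, C₃, hC⟩ := explicitF₅_affine c m₁ m₂ Q2 xhat s₁
    refine integral_affine hm hQ hs hC fun y hy => ?_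
    rw [structureFunction_projector₅ (xhat := xhat) hgs c (hKS y hy).1.physical (hKS y hy).2
      (hs0 y hy) (ht0 y hy) (by rw [(hKS y hy).1.energy, (hKS y hy).1.virtuality]; exact hx),
      ht y hy, (hKS y hy).1.energy, (hKS y hy).1.virtuality]
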